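/- **Colored graphs.** A $\Delta$-colored graph is a finite bipartite graph (white and black vertices, multiple lines allowed) whose lines carry colors from a set of $\Delta$ colors, such that each vertex is incident to exactly one line of each color and each line joins a white to a black vertex. Its faces of colors $\mu\neq\nu$ are the closed loops on which the colors $\mu,\nu$ alternate; $f_{\mu\nu}$ is their number. For a connected $\Delta$-colored graph with $2p$ vertices, a jacket is a cyclic ordering of the $\Delta$ colors up to reversal; its genus $g_J$ is defined by $2p-\Delta p+f_J=2-2g_J$, where $f_J$ is the number of faces whose two colors are neighbors in the cyclic ordering. The degree $\omega$ of a connected graph is the sum of the genera of its jackets ($\omega=0$ if $\Delta=2$); the degree of a disconnected graph is the sum of the degrees of its connected components. $n(\cdot)$ denotes the number of connected components. **Model.** Split the colors $\{1,\dots,d\}$ into $L$ slices $D_1,\dots,D_L$ with $\Delta_l=|D_l|\ge 2$ colors. A bubble is a connected $d$-colored graph $B$. To a complex tensor $T_{a_1\cdots a_d}$ it associates the invariant $B(T,\bar T)$: one $T$ per white vertex, one $\bar T$ per black vertex, the $c$-th indices at the two ends of every line of color $c$ being identified and summed. $B^{(l)}$ is the subgraph with all vertices and the lines with color in $D_l$.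 Let $\{B_i\}_{i\in I}$ be a finite family of bubbles, $B_i$ having $2p_i$ vertices, and let $t_i$ be couplings. For $N\ge1$ and tensors with all indices in $\{1,\dots,N\}$ put $$S=T\cdot\bar T+\sum_{i}t_i\,N^{L-\sum_l n(B_i^{(l)})}B_i(T,\bar T),\qquad Z=e^{-F}=\int dT\,d\bar T\,e^{-N^{d-L}S},\qquad \langle B\rangle=\frac1Z\int dT\,d\bar T\,B(T,\bar T)\,e^{-N^{d-L}S},$$ where the measure is normalized by $Z|_{t=0}=1$ and $Z$, $F$, $\langle B\rangle$ are formal power series in the $t_i$ (expand the exponential of the interaction and integrate term by term against the Gaussian). For $b=(b_i)_{i\in I}\in\mathbb N^I$, a labelled Feynman graph $G$ of type $b$ consists of $b_i$ labelled copies of each $B_i$ together with a perfect matching of all white with all black vertices, whose lines get the color $0$; it is a $(d+1)$-colored graph. Its amplitude $A(G)$ is the product of a factor $N^{d-L}t_iN^{L-\sum_l n(B_i^{(l)})}$ for each copy of $B_i$, a propagator $N^{-(d-L)}\prod_c\delta_{a_cb_c}$ for each line of color $0$, and a Kronecker delta for each line of color $1,\dots,d$, summed over all indices. $G^{(l)}$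 is the subgraph of $G$ with all vertices and the lines with color in $D_l\cup\{0\}$. Write $|b|=\sum_ib_i$, $p=\sum_ib_ip_i$, $b!=\prod_ib_i!$, and $$\Omega_l(G)=\frac{2}{(\Delta_l-1)!}\,\omega(G^{(l)})-\frac{2}{(\Delta_l-2)!}\sum_ib_i\,\omega(B_i^{(l)}),\qquad e_l(G)=\Delta_l\Bigl(n(G^{(l)})-\sum_ib_i\bigl(n(B_i^{(l)})-1\bigr)\Bigr)-\Omega_l(G).$$ **Theorem.** 1. For every connected labelled Feynman graph $G$ of type $b$ and every $l$: $n(G^{(l)})\le 1+\sum_ib_i(n(B_i^{(l)})-1)$, and $\Omega_l(G)$ is a non-negative integer. 2. For every such $G$, every $N\ge1$ and all $t\in\mathbb C^I$, $$A(G)=N^{\sum_{\mu=1}^df_{0\mu}-(d-L)p+d|b|-\sum_ib_i\sum_ln(B_i^{(l)})}\prod_it_i^{b_i},\qquad |A(G)|=\Bigl|\prod_it_i^{b_i}\Bigr|\,N^{\sum_le_l(G)},$$ $$|A(G)|\le\Bigl|\prod_it_i^{b_i}\Bigr|\,N^{\,d-\sum_l\left[\frac{2}{(\Delta_l-1)!}\omega(G^{(l)})-\frac{2}{(\Delta_l-2)!}\sum_ib_i\omega(B_i^{(l)})\right]}\le\Bigl|\prod_it_i^{b_i}\Bigr|\,N^d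 .$$ 3. The free energy has a well-defined $1/N$ expansion: for every $b$ and $N\ge1$ the coefficient of $\prod_it_i^{b_i}$ in $F$ is $$-\frac{(-1)^{|b|}}{b!}\sum_{G}N^{\sum_le_l(G)},$$ the sum being over the connected labelled Feynman graphs of type $b$; and it equals $N^dP_b(1/N)$ for a polynomial $P_b\in\mathbb Q[X]$ that does not depend on $N$. 4. For every bubble $B$, every $b$ and $N\ge1$, the coefficient of $\prod_it_i^{b_i}$ in $\langle B\rangle$ is $$N^{\sum_ln(B^{(l)})}\,\frac{(-1)^{|b|}}{b!}\sum_GN^{\sum_l(e_l(G)-\Delta_l)},$$ the sum being over the connected labelled Feynman graphs made of one marked copy of $B$ and $b_i$ copies of each $B_i$, where in $e_l(G)$ and $\Omega_l(G)$ the sums over bubbles include the marked copy of $B$. Here $e_l(G)\le\Delta_l$ for each $l$, and the coefficient equals $N^{\sum_ln(B^{(l)})}Q_b(1/N)$ for a polynomial $Q_b\in\mathbb Q[X]$ that does not depend on $N$; so $\langle B\rangle$ scales at most like $N^{\sum_ln(B^{(l)})}$. 5. (Rectangular tensors.) Let instead the indices with color in $D_l$ have range $\{1,\dots,N_l\}$,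 $N_l\ge1$, replace the factor $N^{d-L}$ in front of $S$ by $\prod_lN_l^{\Delta_l-1}$ and the suppression of $B_i$ by $\prod_lN_l^{1-n(B_i^{(l)})}$. Then for connected $G$ of type $b$ $$A(G)=\prod_lN_l^{\sum_{\mu\in D_l}f_{0\mu}-(\Delta_l-1)(p-|b|)-\sum_ib_i(n(B_i^{(l)})-1)}\prod_it_i^{b_i},\qquad|A(G)|=\Bigl|\prod_it_i^{b_i}\Bigr|\prod_lN_l^{e_l(G)},$$ $$|A(G)|\le\Bigl|\prod_it_i^{b_i}\Bigr|\prod_lN_l^{\Delta_l-\Omega_l(G)}\le\Bigl|\prod_it_i^{b_i}\Bigr|\prod_lN_l^{\Delta_l};$$ the coefficient of $\prod_it_i^{b_i}$ in $F$ is $-\frac{(-1)^{|b|}}{b!}\sum_G\prod_lN_l^{e_l(G)}$ and equals $\prod_lN_l^{\Delta_l}$ times a polynomial in the $1/N_l$ with rational coefficients that do not depend on the $N_l$; and the coefficient of $\prod_it_i^{b_i}$ in $\langle B\rangle$ is $\prod_lN_l^{n(B^{(l)})}\frac{(-1)^{|b|}}{b!}\sum_G\prod_lN_l^{e_l(G)-\Delta_l}$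 (graphs with a marked copy of $B$ as in 4) and equals $\prod_lN_l^{n(B^{(l)})}$ times such a polynomial. -/

import Mathlib

noncomputable section

namespace TensorModel

/-! ### Colored graphs -/

/-- A closed bipartite graph with white vertices `W`, black vertices `K` and lines colored by `C`,
such that every vertex carries exactly one line of each color: the lines of color `c` form a
perfect matching of `W` with `K` (several lines may join the same two vertices). -/
structure ColoredGraph (C W K : Type) where
  line : C → W ≃ K

namespace ColoredGraph

variable {C W K : Type}

/-- Two vertices are adjacent when some line joins them. -/
def skeleton (G : ColoredGraph C W K) : SimpleGraph (W ⊕ K) :=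
  SimpleGraph.fromRel fun x y => ∃ c w, x = Sum.inl w ∧ y = Sum.inr (G.line c w)

def Connected (G : ColoredGraph C W K) : Prop := G.skeleton.Connected

abbrev Component (G : ColoredGraph C W K) : Type := G.skeleton.ConnectedComponent

/-- The number of connected components. -/
def numComp (G : ColoredGraph C W K) : ℕ := Nat.card G.Component

/-- The subgraph made of all the vertices and of the lines whose color is in `S`. -/
def restrict (G : ColoredGraph C W K) (S : Finset C) : ColoredGraph S W K :=
  ⟨fun c => G.line c⟩

/-- The number of faces of colors `μ, ν`, for `μ ≠ ν`: the connected components of the subgraph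
with the two colors `μ, ν` are exactly the loops on which these colors alternate. -/
def faces [DecidableEq C] (G : ColoredGraph C W K) (μ ν : C) : ℕ :=
  (G.restrict {μ, ν}).numComp

theorem component_line (G : ColoredGraph C W K) (c : C) (w : W) :
    G.skeleton.connectedComponentMk (Sum.inl w) =
      G.skeleton.connectedComponentMk (Sum.inr (G.line c w)) := by
  apply SimpleGraph.ConnectedComponent.connectedComponentMk_eq_of_adj
  refine ⟨by simp, Or.inl ⟨c, w, rfl, rfl⟩⟩

/-- A connected component, as a colored graph of its own. -/
def componentGraph (G : ColoredGraph C W K) (x : G.Component) :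
    ColoredGraph C {w : W // G.skeleton.connectedComponentMk (Sum.inl w) = x}
      {k : K // G.skeleton.connectedComponentMk (Sum.inr k) = x} :=
  ⟨fun c => (G.line c).subtypeEquiv fun w => by rw [G.component_line c w]⟩

/-- The number of faces of the jacket attached to a cycle `σ` on all the colors: the faces of
colors `c, σ c`. -/
def jacketFaces [Fintype C] [DecidableEq C] (G : ColoredGraph C W K) (σ : Equiv.Perm C) : ℕ :=
  ∑ c, G.faces c (σ c)

/-- The genus `g` of a jacket of a connected graph with `2p` vertices, hence `Δp` lines, from
Euler's relation `2p - Δp + f = 2 - 2g`. -/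
def jacketGenus [Fintype C] [DecidableEq C] (G : ColoredGraph C W K) (σ : Equiv.Perm C) : ℚ :=
  (2 - (2 * (Nat.card W : ℚ) - (Fintype.card C : ℚ) * (Nat.card W : ℚ)
    + (G.jacketFaces σ : ℚ))) / 2

open Classical in
/-- The cyclic permutations of the whole set of colors. -/
def fullCycles (C : Type) [Fintype C] [DecidableEq C] : Finset (Equiv.Perm C) :=
  Finset.univ.filter fun σ => σ.IsCycle ∧ σ.support = Finset.univ

/-- The degree of a connected graph: the sum of the genera of its jackets. A jacket is a cycle up
to orientation (`σ` and `σ⁻¹` give the same jacket), whence the factor `1 / 2`.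
With two colors the only term is `0`, so that the degree of a loop is `0`. -/
def connectedDegree [Fintype C] [DecidableEq C] (G : ColoredGraph C W K) : ℚ :=
  (1 / 2) * ∑ σ ∈ fullCycles C, G.jacketGenus σ

/-- The degree `ω(G)` of a graph: the sum of the degrees of its connected components. -/
def degree [Fintype C] [DecidableEq C] (G : ColoredGraph C W K) : ℚ :=
  ∑ᶠ x : G.Component, (G.componentGraph x).connectedDegree

end ColoredGraph

/-! ### Bubbles, tensor invariants and Feynman graphs -/

/-- A bubble: a connected `d`-colored graph with `p` white and `p` black vertices. -/
structure Bubble (d : ℕ) where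
  p : ℕ
  graph : ColoredGraph (Fin d) (Fin p) (Fin p)
  connected : graph.Connected

/-- The positions in a tensor whose index of color `c` has range `n c`. -/
abbrev Index {d : ℕ} (n : Fin d → ℕ) : Type := (c : Fin d) → Fin (n c)

/-- The invariant `B(T, T̄)`: one `T` for each white vertex, one `T̄` for each black vertex, and for
each line of color `c` a summed index shared by the `c`-th indices at its two ends. -/
def Bubble.invariant {d : ℕ} (B : Bubble d) (n : Fin d → ℕ) (T : Index n → ℂ) : ℂ :=
  ∑ a : Fin B.p → Index n,
    (∏ w, T (a w)) * ∏ k, (starRingEnd ℂ) (T fun c => a ((B.graph.line c).symm k) c)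

/-- The white vertices (and also the black vertices) of a family of bubbles. -/
abbrev Vertices {d : ℕ} {J : Type} (B : J → Bubble d) : Type := (j : J) × Fin (B j).p

/-- The `(d+1)`-colored graph obtained from a family of bubbles and a Wick contraction `φ`.
The color `0` is `none`, and the color `c` of the bubbles is `some c`. -/
def feynmanGraph {d : ℕ} {J : Type} (B : J → Bubble d) (φ : Vertices B ≃ Vertices B) :
    ColoredGraph (Option (Fin d)) (Vertices B) (Vertices B) :=
  ⟨fun c => c.elim φ fun c => Equiv.sigmaCongrRight fun j => (B j).graph.line c⟩

open Classical in
/-- The Wick contractions whose Feynman graph is connected. -/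
def connectedContractions {d : ℕ} {J : Type} [Fintype J] (B : J → Bubble d) :
    Finset (Vertices B ≃ Vertices B) :=
  Finset.univ.filter fun φ => (feynmanGraph B φ).Connected

/-- `b i` labelled copies of the bubble `i`, for every `i`. -/
abbrev Copies {I : Type} (b : I →₀ ℕ) : Type := (i : I) × Fin (b i)

def copies {d : ℕ} {I : Type} (B : I → Bubble d) (b : I →₀ ℕ) : Copies b → Bubble d :=
  fun j => B j.1

/-- The same, with one more, marked, bubble `B₀`. -/
def markedCopies {d : ℕ} {I : Type} (B₀ : Bubble d) (B : I → Bubble d) (b : I →₀ ℕ) :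
    Option (Copies b) → Bubble d :=
  fun j => j.elim B₀ (copies B b)

/-! ### Tensor models -/

/-- The data of the model `exp (- scale * S)` with action
`S = T·T̄ + ∑ i, t i * suppression i * B i (T, T̄)`. -/
structure Model (d : ℕ) (I : Type) where
  bubble : I → Bubble d
  size : Fin d → ℕ
  scale : ℝ
  suppression : I → ℝ

namespace Model

variable {d : ℕ} {I : Type}

/-- The Gaussian weight `exp (- scale * T·T̄)`. -/
def gaussianWeight (M : Model d I) (T : Index M.size → ℂ) : ℝ :=
  Real.exp (-M.scale * ∑ a, ‖T a‖ ^ 2)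

/-- Expectation in the normalized Gaussian model (all couplings zero), for the Lebesgue measure on
the components of `T`. -/
def gaussianMean (M : Model d I) (f : (Index M.size → ℂ) → ℂ) : ℂ :=
  (∫ T, f T * (M.gaussianWeight T : ℂ)) / (∫ T, (M.gaussianWeight T : ℂ))

/-- The perturbative expansion, in the couplings `t`, of `∫ f(T) exp (- scale * S)`, where the
measure is normalized by `∫ exp (- scale * T·T̄) = 1`: the exponential of the interaction is expanded
in powers of `t` and each monomial is integrated. -/
def perturbative [Fintype I] (M : Model d I) (f : (Index M.size → ℂ) → ℂ) : MvPowerSeries I ℂ :=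
  fun b => (∏ i, ((-(M.scale * M.suppression i : ℝ) : ℂ) ^ b i / (Nat.factorial (b i) : ℂ))) *
    M.gaussianMean fun T => f T * ∏ i, (M.bubble i).invariant M.size T ^ b i

/-- The partition function `Z`, as a formal power series in the couplings. -/
def partitionFunction [Fintype I] (M : Model d I) : MvPowerSeries I ℂ :=
  M.perturbative fun _ => 1

/-- The free energy `F = - log Z`. -/
def freeEnergy [Fintype I] (M : Model d I) : MvPowerSeries I ℂ :=
  -(PowerSeries.log ℂ).subst (M.partitionFunction - 1)

/-- The expectation value `⟨B₀(T, T̄)⟩ = Z⁻¹ ∫ B₀(T, T̄) exp (- scale * S)`. -/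
def expectation [Fintype I] (M : Model d I) (B₀ : Bubble d) : MvPowerSeries I ℂ :=
  M.perturbative (fun T => B₀.invariant M.size T) * M.partitionFunction⁻¹

/-- The propagator. -/
def propagator (M : Model d I) (x y : Index M.size) : ℂ :=
  if x = y then ((M.scale : ℂ))⁻¹ else 0

open Classical in
/-- The amplitude of the Feynman graph with `b i` bubbles `i` and Wick contraction `φ`: a factor
`scale * t i * suppression i` for each bubble, a propagator for each line of color `0`, a Kronecker
delta for each line of color `c` of a bubble, all indices being summed. -/
def amplitude [Fintype I] (M : Model d I) (t : I → ℂ) (b : I →₀ ℕ)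
    (φ : Vertices (copies M.bubble b) ≃ Vertices (copies M.bubble b)) : ℂ :=
  (∏ i, (((M.scale * M.suppression i : ℝ) : ℂ) * t i) ^ b i) *
    ∑ x : Vertices (copies M.bubble b) → Index M.size,
      ∑ y : Vertices (copies M.bubble b) → Index M.size,
        (∏ v, ∏ c,
          if x v c = y ((feynmanGraph (copies M.bubble b) φ).line (some c) v) c then (1 : ℂ) else 0) *
        ∏ v, M.propagator (x v) (y ((feynmanGraph (copies M.bubble b) φ).line none v))

end Model

/-! ### Color slices -/

section Slices

variable {d L : ℕ}

/-- The set `D_l` of colors in the slice `l`. -/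
def slice (s : Fin d → Fin L) (l : Fin L) : Finset (Fin d) :=
  Finset.univ.filter fun c => s c = l

/-- `Δ_l`, the number of colors in the slice `l`. -/
def width (s : Fin d → Fin L) (l : Fin L) : ℕ := (slice s l).card

/-- `n(B^(l))`, where `B^(l)` is the subgraph with the colors of the slice `l`. -/
def bubbleComp (s : Fin d → Fin L) (B : Bubble d) (l : Fin L) : ℕ :=
  (B.graph.restrict (slice s l)).numComp

/-- `ω(B^(l))`. -/
def bubbleDegree (s : Fin d → Fin L) (B : Bubble d) (l : Fin L) : ℚ :=
  (B.graph.restrict (slice s l)).degree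

/-- `n(G^(l))`, where `G^(l)` is the subgraph with the color `0` and the colors of the slice `l`. -/
def graphComp (s : Fin d → Fin L) {W K : Type} (G : ColoredGraph (Option (Fin d)) W K)
    (l : Fin L) : ℕ :=
  (G.restrict (Finset.insertNone (slice s l))).numComp

/-- `ω(G^(l))`. -/
def graphDegree (s : Fin d → Fin L) {W K : Type} (G : ColoredGraph (Option (Fin d)) W K)
    (l : Fin L) : ℚ :=
  (G.restrict (Finset.insertNone (slice s l))).degree

/-- The degrees of the slice `l` in a graph `G` made of the bubbles `B j`:
`2/(Δ_l-1)! ω(G^(l)) - 2/(Δ_l-2)! ∑ j, ω(B_j^(l))`. -/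
def degreePart (s : Fin d → Fin L) {J : Type} [Fintype J] (B : J → Bubble d)
    (φ : Vertices B ≃ Vertices B) (l : Fin L) : ℚ :=
  2 / (Nat.factorial (width s l - 1) : ℚ) * graphDegree s (feynmanGraph B φ) l
    - 2 / (Nat.factorial (width s l - 2) : ℚ) * ∑ j, bubbleDegree s (B j) l

/-- The exponent of the size of the slice `l` in the amplitude of a graph `G` made of the
bubbles `B j`: `Δ_l (n(G^(l)) - ∑ j, (n(B_j^(l)) - 1))` minus the degrees of the slice. -/
def sliceExponent (s : Fin d → Fin L) {J : Type} [Fintype J] (B : J → Bubble d)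
    (φ : Vertices B ≃ Vertices B) (l : Fin L) : ℚ :=
  (width s l : ℚ) *
      ((graphComp s (feynmanGraph B φ) l : ℚ) - ∑ j, ((bubbleComp s (B j) l : ℚ) - 1))
    - degreePart s B φ l

/-- Tensors of size `N` in every direction, scale `N^(d-L)`, and suppressions
`N^(L - ∑ l, n(B_i^(l)))`. -/
def squareModel (s : Fin d → Fin L) {I : Type} (B : I → Bubble d) (N : ℕ) : Model d I where
  bubble := B
  size := fun _ => N
  scale := (N : ℝ) ^ ((d : ℤ) - (L : ℤ))
  suppression := fun i => (N : ℝ) ^ ((L : ℤ) - ∑ l, (bubbleComp s (B i) l : ℤ))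

/-- Tensors of size `N l` in the directions of the slice `l`, scale `∏ l, N_l^(Δ_l-1)`, and
suppressions `∏ l, N_l^(1 - n(B_i^(l)))`. -/
def rectangularModel (s : Fin d → Fin L) {I : Type} (B : I → Bubble d) (N : Fin L → ℕ) :
    Model d I where
  bubble := B
  size := fun c => N (s c)
  scale := ∏ l, (N l : ℝ) ^ ((width s l : ℤ) - 1)
  suppression := fun i => ∏ l, (N l : ℝ) ^ (1 - (bubbleComp s (B i) l : ℤ))

end Slices

end TensorModel

end

/-! Everything reduces to counting faces. Summing the indices of a Feynman graph leaves one free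
index per face of colors `0, c`, so an amplitude is a monomial in the sizes, and the exponent of the
slice `l` is the integer `faceExponent`. Averaging Euler's relation over all jackets expresses the
number of faces within a set of colors through components, vertices and degree
(`ColoredGraph.facesWithin_eq`). Subtracting this count for `D_l` from the one for `D_l ∪ {0}`
leaves exactly the faces through color `0`. Hence Ω_l is an integer combination of counts
(`degreePart_eq`), and e_l equals the face exponent (`sliceExponent_eq`).

Two inequalities then bound the exponents. The number of components n(S) of the subgraph with colors
in S is the dimension of the space of functions constant along these lines, so n(S) + n(T) ≤ n(S ∪
T) + n(S ∩ T) (`ColoredGraph.numComp_add_le`). With S = D_l ∪ {0} and T the colors of the bubbles,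
this is the bound on n(G^(l)). Non-negativity of Ω_l comes from the genus inequality for three
colors, proved by the orthogonality of boundaries and coboundaries: submodularity transports it from
{0, μ, ν} to D_l ∪ {0}, and averaging over the pairs μ, ν in D_l gives `ColoredGraph.sum_faces_le`.

For the power series, Wick's theorem turns Gaussian means of invariants into sums over contractions.
Cutting out the connected component of a marked bubble shows that an insertion of B is (connected
graphs with a marked B) times Z. This gives ⟨B⟩ at once. Since ∂Z/∂t_i inserts a marked B_i, it also
shows that log Z and the series of connected graphs have the same partial derivatives, which is the
linked cluster theorem `Model.freeEnergy_eq`. The square model is the rectangular one with equal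
sizes. -/

noncomputable section

namespace TensorModel

/-! ### Connected components counted by invariant functions -/

namespace ColoredGraph

variable {C W K : Type}

/-- A function on the vertices that takes the same value at both ends of every line. -/
def IsInvariant (G : ColoredGraph C W K) {α : Type*} (g : W ⊕ K → α) : Prop :=
  ∀ c w, g (Sum.inl w) = g (Sum.inr (G.line c w))

theorem IsInvariant.eq_of_reachable {G : ColoredGraph C W K} {α : Type*} {g : W ⊕ K → α}
    (hg : G.IsInvariant g) {x y : W ⊕ K} (h : G.skeleton.Reachable x y) : g x = g y := by
  obtain ⟨p⟩ := h
  induction p with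
  | nil => rfl
  | cons hadj _ ih =>
    rw [← ih]
    rcases hadj with ⟨-, ⟨c, w, rfl, rfl⟩ | ⟨c, w, rfl, rfl⟩⟩
    · exact hg c w
    · exact (hg c w).symm

theorem isInvariant_comp_component (G : ColoredGraph C W K) {α : Type*} (f : G.Component → α) :
    G.IsInvariant fun x => f (G.skeleton.connectedComponentMk x) :=
  fun c w => congrArg f (G.component_line c w)

/-- Invariant functions are the functions of the connected component. -/
def invariantEquiv (G : ColoredGraph C W K) (α : Type*) :
    {g : W ⊕ K → α // G.IsInvariant g} ≃ (G.Component → α) where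
  toFun g := fun x => x.lift g.1 fun _ _ p _ => g.2.eq_of_reachable p.reachable
  invFun f := ⟨_, G.isInvariant_comp_component f⟩
  left_inv g := by ext x; rfl
  right_inv f := by
    ext x
    induction x using SimpleGraph.ConnectedComponent.ind
    rfl

instance [Finite W] [Finite K] (G : ColoredGraph C W K) : Finite G.Component :=
  Quot.finite _

/-- This serves twice: with `α = Bool` it recovers the number of components from a cardinality, and
with `α` an index range it evaluates index sums. -/
theorem card_invariant [Finite W] [Finite K] (G : ColoredGraph C W K) (α : Type*) :
    Nat.card {g : W ⊕ K → α // G.IsInvariant g} = Nat.card α ^ G.numComp := by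
  rw [Nat.card_congr (G.invariantEquiv α), Nat.card_fun, numComp]

theorem Connected.numComp_eq_one {G : ColoredGraph C W K} (h : G.Connected) : G.numComp = 1 := by
  rw [numComp, Nat.card_eq_one_iff_unique]
  exact ⟨h.preconnected.subsingleton_connectedComponent,
    h.nonempty.map G.skeleton.connectedComponentMk⟩

/-- Belonging to the component of a given vertex is itself an invariant predicate, so invariant
predicates detect connectedness. -/
theorem connected_of_invariant {G : ColoredGraph C W K} [Nonempty (W ⊕ K)]
    (h : ∀ g : W ⊕ K → Prop, G.IsInvariant g → ∀ x y, g x → g y) : G.Connected := by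
  refine (SimpleGraph.connected_iff _).2 ⟨fun x y => ?_, ‹_›⟩
  refine SimpleGraph.ConnectedComponent.exact ?_
  exact (h _ (G.isInvariant_comp_component fun z => G.skeleton.connectedComponentMk x = z) x y rfl)

/-- The number of components is additive over a decomposition into disjoint subgraphs. -/
theorem numComp_eq_sum {ι : Type*} [Fintype ι] [Finite W] [Finite K] {W' K' : ι → Type}
    [∀ x, Finite (W' x)] [∀ x, Finite (K' x)]
    (G : ColoredGraph C W K) (H : ∀ x, ColoredGraph C (W' x) (K' x))
    (eW : (Σ x, W' x) ≃ W) (eK : (Σ x, K' x) ≃ K)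
    (h : ∀ c x w, G.line c (eW ⟨x, w⟩) = eK ⟨x, (H x).line c w⟩) :
    G.numComp = ∑ x, (H x).numComp := by
  let FW (f : ∀ x, {g : W' x ⊕ K' x → Bool // (H x).IsInvariant g}) (z : Σ x, W' x) : Bool :=
    (f z.1).1 (Sum.inl z.2)
  let FK (f : ∀ x, {g : W' x ⊕ K' x → Bool // (H x).IsInvariant g}) (z : Σ x, K' x) : Bool :=
    (f z.1).1 (Sum.inr z.2)
  let E : {g : W ⊕ K → Bool // G.IsInvariant g} ≃
      ∀ x, {g : W' x ⊕ K' x → Bool // (H x).IsInvariant g} :=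
    { toFun := fun g x => ⟨fun v => g.1 (v.elim (fun w => Sum.inl (eW ⟨x, w⟩))
          (fun k => Sum.inr (eK ⟨x, k⟩))), fun c w => by
            simpa [h] using g.2 c (eW ⟨x, w⟩)⟩
      invFun := fun f => ⟨fun v => v.elim (fun w => FW f (eW.symm w)) (fun k => FK f (eK.symm k)),
        fun c w => by
          obtain ⟨⟨x, w⟩, rfl⟩ := eW.surjective w
          simp only [Sum.elim_inl, Sum.elim_inr, h, Equiv.symm_apply_apply]
          exact (f x).2 c w⟩
      left_inv := fun g => by
        ext (w | k) <;> simp [FW, FK]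
      right_inv := fun f => by
        ext x (w | k) <;> simp only [Sum.elim_inl, Sum.elim_inr, Equiv.symm_apply_apply] <;> rfl }
  -- Both sides count `Bool`-valued invariant functions, that is, powers of 2 whose exponents are
  -- the numbers of components.
  have h1 := Nat.card_congr E
  rw [Nat.card_pi, card_invariant] at h1
  simp only [card_invariant, Finset.prod_pow_eq_pow_sum] at h1
  exact Nat.pow_right_injective (le_of_eq (by simp)) h1

/-- The space of invariant functions with rational values. -/
def invariantSubmodule (G : ColoredGraph C W K) : Submodule ℚ (W ⊕ K → ℚ) where
  carrier := {g | G.IsInvariant g}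
  add_mem' ha hb c w := congrArg₂ (· + ·) (ha c w) (hb c w)
  zero_mem' _ _ := rfl
  smul_mem' r _ ha c w := congrArg (r * ·) (ha c w)

theorem mem_invariantSubmodule {G : ColoredGraph C W K} {g : W ⊕ K → ℚ} :
    g ∈ G.invariantSubmodule ↔ G.IsInvariant g := Iff.rfl

/-- Reading the number of components as a dimension gives access to the dimension formula for sums
and intersections, and to rank-nullity. -/
theorem finrank_invariantSubmodule [Finite W] [Finite K] (G : ColoredGraph C W K) :
    Module.finrank ℚ G.invariantSubmodule = G.numComp := by
  let e : G.invariantSubmodule ≃ₗ[ℚ] (G.Component → ℚ) :=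
    { G.invariantEquiv ℚ with
      map_add' := fun a b => by
        ext x
        induction x using SimpleGraph.ConnectedComponent.ind
        rfl
      map_smul' := fun a b => by
        ext x
        induction x using SimpleGraph.ConnectedComponent.ind
        rfl }
  have := Fintype.ofFinite G.Component
  rw [e.finrank_eq, Module.finrank_fintype_fun_eq_card, numComp, Nat.card_eq_fintype_card]

theorem isInvariant_restrict {G : ColoredGraph C W K} {S : Finset C} {α : Type*} {g : W ⊕ K → α} :
    (G.restrict S).IsInvariant g ↔ ∀ c ∈ S, ∀ w, g (Sum.inl w) = g (Sum.inr (G.line c w)) :=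
  ⟨fun h c hc w => h ⟨c, hc⟩ w, fun h c w => h c c.2 w⟩

/-- The number of components is a submodular function of the set of colors. -/
theorem numComp_add_le [DecidableEq C] [Finite W] [Finite K] (G : ColoredGraph C W K)
    (S T : Finset C) :
    (G.restrict S).numComp + (G.restrict T).numComp ≤
      (G.restrict (S ∪ T)).numComp + (G.restrict (S ∩ T)).numComp := by
  simp only [← finrank_invariantSubmodule]
  -- Invariance along `S ∪ T` is exactly the intersection of the two spaces, whereas their sum is
  -- only contained in the functions invariant along `S ∩ T`. This inclusion is the source of the
  -- inequality.
  have h1 : (G.restrict (S ∪ T)).invariantSubmodule =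
      (G.restrict S).invariantSubmodule ⊓ (G.restrict T).invariantSubmodule := by
    ext g
    simp only [Submodule.mem_inf, mem_invariantSubmodule, isInvariant_restrict, Finset.mem_union]
    exact ⟨fun h => ⟨fun c hc => h c (Or.inl hc), fun c hc => h c (Or.inr hc)⟩,
      fun h c hc => hc.elim (h.1 c) (h.2 c)⟩
  have h2 : (G.restrict S).invariantSubmodule ⊔ (G.restrict T).invariantSubmodule ≤
      (G.restrict (S ∩ T)).invariantSubmodule := by
    refine sup_le (fun g hg => ?_) fun g hg => ?_ <;>
    · rw [mem_invariantSubmodule, isInvariant_restrict] at hg ⊢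
      intro c hc
      exact hg c (by simp_all)
  have := Fintype.ofFinite W
  have := Fintype.ofFinite K
  rw [h1, ← Submodule.finrank_sup_add_finrank_inf_eq, add_comm]
  exact Nat.add_le_add_left (Submodule.finrank_mono h2) _

theorem numComp_restrict_univ [Fintype C] (G : ColoredGraph C W K) :
    (G.restrict Finset.univ).numComp = G.numComp := by
  have : (G.restrict Finset.univ).skeleton = G.skeleton := by
    ext x y
    simp [skeleton, restrict]
  rw [numComp, numComp, Component, Component, this]

theorem faces_comm [DecidableEq C] (G : ColoredGraph C W K) (i j : C) :
    G.faces i j = G.faces j i := by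
  rw [faces, faces, Finset.pair_comm]

theorem card_eq [Finite W] [Finite K] [Nonempty C] (G : ColoredGraph C W K) :
    Nat.card K = Nat.card W :=
  (Nat.card_congr (G.line (Classical.arbitrary C))).symm

/-! ### The genus inequality for three colors, by homology -/

/-- The coboundary of a function on the vertices, on the lines of three colors. -/
def lineCoboundary (G : ColoredGraph C W K) (i j k : C) :
    (W ⊕ K → ℚ) →ₗ[ℚ] (W → ℚ) × (W → ℚ) × (W → ℚ) where
  toFun g := (fun w => g (Sum.inl w) - g (Sum.inr (G.line i w)),
    fun w => g (Sum.inl w) - g (Sum.inr (G.line j w)),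
    fun w => g (Sum.inl w) - g (Sum.inr (G.line k w)))
  map_add' a b := by
    ext <;> simp <;> ring
  map_smul' r a := by
    ext <;> simp <;> ring

/-- The boundary of a function on the faces of three colors, a function on their lines. -/
def faceBoundary [DecidableEq C] (G : ColoredGraph C W K) (i j k : C) :
    ((G.restrict {i, j}).invariantSubmodule × (G.restrict {j, k}).invariantSubmodule ×
      (G.restrict {k, i}).invariantSubmodule) →ₗ[ℚ] (W → ℚ) × (W → ℚ) × (W → ℚ) where
  toFun g := (fun w => g.1.1 (Sum.inl w) - g.2.2.1 (Sum.inl w),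
    fun w => g.2.1.1 (Sum.inl w) - g.1.1 (Sum.inl w),
    fun w => g.2.2.1 (Sum.inl w) - g.2.1.1 (Sum.inl w))
  map_add' a b := by
    ext <;> simp <;> ring
  map_smul' r a := by
    ext <;> simp <;> ring

theorem ker_lineCoboundary [DecidableEq C] (G : ColoredGraph C W K) (i j k : C) :
    LinearMap.ker (G.lineCoboundary i j k) = (G.restrict {i, j, k}).invariantSubmodule := by
  ext g
  simp [lineCoboundary, mem_invariantSubmodule, isInvariant_restrict, funext_iff, sub_eq_zero]

/-- Zero boundary forces the two faces that meet along any line to carry the same value. The three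
face functions then agree at all vertices and form one function invariant along the three colors,
hence at most one degree of freedom per component. -/
theorem finrank_ker_faceBoundary_le [DecidableEq C] [Fintype W] [Fintype K]
    (G : ColoredGraph C W K) (i j k : C) :
    Module.finrank ℚ (LinearMap.ker (G.faceBoundary i j k)) ≤
      (G.restrict {i, j, k}).numComp := by
  rw [← finrank_invariantSubmodule]
  have key : ∀ g ∈ LinearMap.ker (G.faceBoundary i j k),
      g.1.1 = g.2.1.1 ∧ g.2.2.1 = g.2.1.1 := by
    rintro ⟨⟨a, ha⟩, ⟨b, hb⟩, ⟨c, hc⟩⟩ h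
    rw [mem_invariantSubmodule, isInvariant_restrict] at ha hb hc
    simp only [faceBoundary, LinearMap.mem_ker, LinearMap.coe_mk, AddHom.coe_mk,
      Prod.mk_eq_zero, funext_iff, Pi.zero_apply, sub_eq_zero] at h
    obtain ⟨h1, h2, h3⟩ := h
    refine ⟨?_, ?_⟩ <;> ext (w | v)
    · exact (h2 w).symm
    · obtain ⟨w, rfl⟩ := (G.line j).surjective v
      exact (ha j (by simp) w).symm.trans ((h2 w).symm.trans (hb j (by simp) w))
    · exact h3 w
    · obtain ⟨w, rfl⟩ := (G.line k).surjective v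
      exact (hc k (by simp) w).symm.trans ((h3 w).trans (hb k (by simp) w))
  let f : LinearMap.ker (G.faceBoundary i j k) →ₗ[ℚ] (G.restrict {i, j, k}).invariantSubmodule :=
    { toFun := fun g => ⟨g.1.2.1.1, by
        have h := key g.1 g.2
        have ha := g.1.1.2
        have hb := g.1.2.1.2
        rw [h.1] at ha
        rw [mem_invariantSubmodule, isInvariant_restrict] at ha hb ⊢
        intro c hc
        simp only [Finset.mem_insert, Finset.mem_singleton] at hc
        rcases hc with rfl | rfl | rfl
        · exact ha _ (by simp)
        · exact ha _ (by simp)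
        · exact hb _ (by simp)⟩
      map_add' := fun _ _ => rfl
      map_smul' := fun _ _ => rfl }
  refine LinearMap.finrank_le_finrank_of_injective (f := f) fun g g' h => ?_
  have h0 : g.1.2.1.1 = g'.1.2.1.1 := congrArg (fun z => z.1) h
  have h1 := key g.1 g.2
  have h2 := key g'.1 g'.2
  ext1
  refine Prod.ext (Subtype.ext ?_) (Prod.ext (Subtype.ext h0) (Subtype.ext ?_))
  · rw [h1.1, h2.1, h0]
  · rw [h1.2, h2.2, h0]

/-- The genus of a graph with three colors is non-negative. -/
theorem faces_add_faces_add_faces_le [DecidableEq C] [Finite W] [Finite K]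
    (G : ColoredGraph C W K) (i j k : C) :
    G.faces i j + G.faces j k + G.faces k i ≤
      Nat.card W + 2 * (G.restrict {i, j, k}).numComp := by
  have := Fintype.ofFinite W
  have := Fintype.ofFinite K
  have : Nonempty C := ⟨i⟩
  have h1 := (G.lineCoboundary i j k).finrank_range_add_finrank_ker
  have h2 := (G.faceBoundary i j k).finrank_range_add_finrank_ker
  have h3 := G.finrank_ker_faceBoundary_le i j k
  have hK := G.card_eq
  rw [ker_lineCoboundary, finrank_invariantSubmodule] at h1
  simp only [Module.finrank_prod, finrank_invariantSubmodule] at h2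
  rw [Module.finrank_fintype_fun_eq_card, Fintype.card_sum] at h1
  -- Coboundaries and boundaries are orthogonal for the standard scalar product on functions of the
  -- lines, so a common element has squared norm zero.
  have h4 : Disjoint (LinearMap.range (G.lineCoboundary i j k))
      (LinearMap.range (G.faceBoundary i j k)) := by
    rw [Submodule.disjoint_def]
    rintro _ ⟨g, rfl⟩ ⟨⟨⟨a, ha⟩, ⟨b, hb⟩, ⟨c, hc⟩⟩, h⟩
    rw [mem_invariantSubmodule, isInvariant_restrict] at ha hb hc
    simp only [faceBoundary, lineCoboundary, LinearMap.coe_mk, AddHom.coe_mk, Prod.mk.injEq,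
      funext_iff] at h
    obtain ⟨e1, e2, e3⟩ := h
    have key : ∑ w, ((g (Sum.inl w) - g (Sum.inr (G.line i w))) ^ 2 +
        (g (Sum.inl w) - g (Sum.inr (G.line j w))) ^ 2 +
        (g (Sum.inl w) - g (Sum.inr (G.line k w))) ^ 2) = 0 := by
      -- Pairing the coboundary with the boundary, the term at the white end vanishes because the
      -- three face differences there add up to zero. Only the black ends remain, and the face
      -- functions may be evaluated there by invariance.
      have e4 : ∀ w, (g (Sum.inl w) - g (Sum.inr (G.line i w))) ^ 2 +
        (g (Sum.inl w) - g (Sum.inr (G.line j w))) ^ 2 +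
        (g (Sum.inl w) - g (Sum.inr (G.line k w))) ^ 2 =
          - (g (Sum.inr (G.line i w)) *
              (a (Sum.inr (G.line i w)) - c (Sum.inr (G.line i w)))
            + g (Sum.inr (G.line j w)) *
              (b (Sum.inr (G.line j w)) - a (Sum.inr (G.line j w)))
            + g (Sum.inr (G.line k w)) *
              (c (Sum.inr (G.line k w)) - b (Sum.inr (G.line k w)))) := by
        intro w
        rw [← ha i (by simp), ← ha j (by simp), ← hb j (by simp), ← hb k (by simp),
          ← hc k (by simp), ← hc i (by simp)]
        linear_combination -(g (Sum.inl w) - g (Sum.inr (G.line i w))) * e1 w -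
          (g (Sum.inl w) - g (Sum.inr (G.line j w))) * e2 w -
          (g (Sum.inl w) - g (Sum.inr (G.line k w))) * e3 w
      -- Each color matches the white with the black vertices, so the three sums can be indexed by
      -- black vertices, where the face differences cancel again.
      rw [Finset.sum_congr rfl fun w _ => e4 w, Finset.sum_neg_distrib, Finset.sum_add_distrib,
        Finset.sum_add_distrib,
        (G.line i).sum_comp fun v => g (Sum.inr v) * (a (Sum.inr v) - c (Sum.inr v)),
        (G.line j).sum_comp fun v => g (Sum.inr v) * (b (Sum.inr v) - a (Sum.inr v)),
        (G.line k).sum_comp fun v => g (Sum.inr v) * (c (Sum.inr v) - b (Sum.inr v)),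
        ← Finset.sum_add_distrib, ← Finset.sum_add_distrib, neg_eq_zero]
      exact Finset.sum_eq_zero fun v _ => by ring
    rw [Finset.sum_eq_zero_iff_of_nonneg fun w _ => by positivity] at key
    simp only [lineCoboundary, LinearMap.coe_mk, AddHom.coe_mk, Prod.mk_eq_zero, funext_iff,
      Pi.zero_apply]
    refine ⟨fun w => ?_, fun w => ?_, fun w => ?_⟩ <;> have := key w (Finset.mem_univ w) <;>
      rw [← sq_eq_zero_iff] <;> nlinarith [sq_nonneg (g (Sum.inl w) - g (Sum.inr (G.line i w))),
        sq_nonneg (g (Sum.inl w) - g (Sum.inr (G.line j w))),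
        sq_nonneg (g (Sum.inl w) - g (Sum.inr (G.line k w)))]
  -- With p white vertices, n components and f faces, the ranks are 2p - n and at least f - n,
  -- inside a space of dimension 3p; so f ≤ p + 2n.
  have h5 := Submodule.finrank_add_finrank_le_of_disjoint h4
  simp only [Module.finrank_prod, Module.finrank_fintype_fun_eq_card] at h5
  rw [Nat.card_eq_fintype_card, Nat.card_eq_fintype_card] at hK
  rw [faces, faces, faces, Nat.card_eq_fintype_card]
  omega

/-! ### Bounds on the number of faces -/

/-- The genus inequality for a, μ, ν involves the components of {a, μ, ν}. Submodularity with `S`,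
whose intersection with {a, μ, ν} is {μ, ν}, replaces them by those of `insert a S`, at the cost of
reversing the sign of the faces μν. -/
theorem faces_add_faces_le [DecidableEq C] [Finite W] [Finite K] (G : ColoredGraph C W K)
    {S : Finset C} {a μ ν : C} (ha : a ∉ S) (hμ : μ ∈ S) (hν : ν ∈ S) :
    (G.faces a μ + G.faces a ν : ℚ) ≤ Nat.card W + G.faces μ ν +
      2 * (G.restrict (insert a S)).numComp - 2 * (G.restrict S).numComp := by
  have h1 := G.faces_add_faces_add_faces_le a μ ν
  have h2 := G.numComp_add_le {a, μ, ν} S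
  have h3 : ({a, μ, ν} : Finset C) ∪ S = insert a S := by
    ext x; simp only [Finset.mem_union, Finset.mem_insert, Finset.mem_singleton]; grind
  have h4 : ({a, μ, ν} : Finset C) ∩ S = {μ, ν} := by
    ext x; simp only [Finset.mem_inter, Finset.mem_insert, Finset.mem_singleton]; grind
  rw [h3, h4] at h2
  change _ ≤ _ + G.faces μ ν at h2
  rw [G.faces_comm ν a] at h1
  have h1' : (G.faces a μ + G.faces μ ν + G.faces a ν : ℚ) ≤
    Nat.card W + 2 * (G.restrict {a, μ, ν}).numComp := by exact_mod_cast h1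
  have h2' : ((G.restrict {a, μ, ν}).numComp + (G.restrict S).numComp : ℚ) ≤
    (G.restrict (insert a S)).numComp + G.faces μ ν := by exact_mod_cast h2
  linarith

/-- Twice the number of faces with colors in `S`. -/
def facesWithin [DecidableEq C] (G : ColoredGraph C W K) (S : Finset C) : ℚ :=
  ∑ x ∈ S.offDiag, (G.faces x.1 x.2 : ℚ)

theorem sum_offDiag [DecidableEq C] (S : Finset C) (f : C → C → ℚ) :
    ∑ x ∈ S.offDiag, f x.1 x.2 = ∑ x ∈ S, ∑ y ∈ S.erase x, f x y := by
  refine Finset.sum_finset_product' _ _ _ fun x => ?_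
  simp only [Finset.mem_offDiag, Finset.mem_erase]
  grind

theorem sum_offDiag_fst [DecidableEq C] (S : Finset C) (f : C → ℚ) :
    ∑ x ∈ S.offDiag, f x.1 = ((S.card : ℚ) - 1) * ∑ x ∈ S, f x := by
  rw [sum_offDiag S (fun x y => f x), Finset.mul_sum]
  refine Finset.sum_congr rfl fun x hx => ?_
  rw [Finset.sum_const, Finset.card_erase_of_mem hx, nsmul_eq_mul,
    Nat.cast_sub (Finset.card_pos.2 ⟨x, hx⟩), Nat.cast_one]

theorem sum_offDiag_snd [DecidableEq C] (S : Finset C) (f : C → ℚ) :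
    ∑ x ∈ S.offDiag, f x.2 = ((S.card : ℚ) - 1) * ∑ x ∈ S, f x := by
  rw [← sum_offDiag_fst]
  refine Finset.sum_nbij' Prod.swap Prod.swap ?_ ?_ ?_ ?_ ?_ <;> simp <;> grind

theorem card_offDiag_cast [DecidableEq C] (S : Finset C) :
    (S.offDiag.card : ℚ) = S.card * ((S.card : ℚ) - 1) := by
  have := sum_offDiag_fst S fun _ => 1
  simpa [mul_comm] using this

theorem facesWithin_insert [DecidableEq C] (G : ColoredGraph C W K) {S : Finset C} {a : C}
    (ha : a ∉ S) :
    G.facesWithin (insert a S) = G.facesWithin S + 2 * ∑ μ ∈ S, (G.faces a μ : ℚ) := by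
  rw [facesWithin, facesWithin, Finset.offDiag_insert ha, Finset.sum_union, Finset.sum_union,
    Finset.sum_product, Finset.sum_product, two_mul, ← add_assoc]
  · simp [G.faces_comm a]
  · rw [Finset.disjoint_left]
    rintro ⟨x, y⟩
    simp only [Finset.mem_offDiag, Finset.mem_product, Finset.mem_singleton]
    grind
  · rw [Finset.disjoint_left]
    rintro ⟨x, y⟩
    simp only [Finset.mem_union, Finset.mem_offDiag, Finset.mem_product, Finset.mem_singleton]
    grind

/-- Sum of `faces_add_faces_le` over the ordered pairs of distinct colors of `S`: each color occurs
`S.card - 1` times in either position. -/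
theorem two_mul_sum_faces_le [DecidableEq C] [Finite W] [Finite K] (G : ColoredGraph C W K)
    {S : Finset C} {a : C} (ha : a ∉ S) :
    2 * ((S.card : ℚ) - 1) * ∑ μ ∈ S, (G.faces a μ : ℚ) ≤ G.facesWithin S +
      S.card * ((S.card : ℚ) - 1) * (Nat.card W + 2 * (G.restrict (insert a S)).numComp -
        2 * (G.restrict S).numComp) := by
  have h : ∑ x ∈ S.offDiag, (G.faces a x.1 + G.faces a x.2 : ℚ) ≤ ∑ x ∈ S.offDiag,
      (G.faces x.1 x.2 + (Nat.card W + 2 * (G.restrict (insert a S)).numComp -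
        2 * (G.restrict S).numComp) : ℚ) := by
    refine Finset.sum_le_sum fun x hx => ?_
    rw [Finset.mem_offDiag] at hx
    linarith [G.faces_add_faces_le ha hx.1 hx.2.1]
  rw [Finset.sum_add_distrib, sum_offDiag_fst S fun μ => (G.faces a μ : ℚ),
    sum_offDiag_snd S fun μ => (G.faces a μ : ℚ), Finset.sum_add_distrib, Finset.sum_const,
    nsmul_eq_mul, card_offDiag_cast] at h
  rw [facesWithin]
  linarith

/-- The degree is non-negative. -/
theorem facesWithin_le [DecidableEq C] [Finite W] [Finite K] (G : ColoredGraph C W K)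
    {S : Finset C} (hS : S.Nonempty) :
    G.facesWithin S ≤ 2 * ((S.card : ℚ) - 1) * (G.restrict S).numComp +
      ((S.card : ℚ) - 1) * ((S.card : ℚ) - 2) * Nat.card W := by
  induction hS using Finset.Nonempty.cons_induction with
  | singleton a => simp [facesWithin]
  | cons a S ha hS ih =>
    rw [Finset.cons_eq_insert]
    rw [Finset.card_insert_of_notMem ha, facesWithin_insert G ha]
    have key := G.two_mul_sum_faces_le ha
    have hc : 1 ≤ S.card := Finset.card_pos.2 hS
    -- For a single color in `S` the averaged inequality is void, there being no pairs; but then the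
    -- faces are the components of the two-color graph.
    rcases hc.eq_or_lt with h1 | h1
    · obtain ⟨b, rfl⟩ := Finset.card_eq_one.1 h1.symm
      simp [facesWithin, faces]
      norm_num
    · have h2 : (0 : ℚ) < S.card - 1 := by
        rw [sub_pos]; exact_mod_cast h1
      push_cast
      refine le_of_mul_le_mul_left ?_ h2
      set Δ : ℚ := (S.card : ℚ)
      have hΔ : 0 ≤ Δ := by linarith
      -- After multiplication by Δ - 1, the faces within `S` appear Δ - 1 times on their own and
      -- once more through `key`, so the induction hypothesis is used Δ times.
      have := mul_le_mul_of_nonneg_left ih hΔ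
      nlinarith

/-- The averaged inequality, with the faces within `S` bounded by `facesWithin_le`. For `a` the
color `0` and `S` a slice, it says precisely that the degree part Ω_l is non-negative. -/
theorem sum_faces_le [DecidableEq C] [Finite W] [Finite K] (G : ColoredGraph C W K)
    {S : Finset C} {a : C} (ha : a ∉ S) (hS : S.Nonempty) :
    ∑ μ ∈ S, (G.faces a μ : ℚ) ≤ S.card * (G.restrict (insert a S)).numComp +
      ((S.card : ℚ) - 1) * (Nat.card W - (G.restrict S).numComp) := by
  have key := G.two_mul_sum_faces_le ha
  have hc : 1 ≤ S.card := Finset.card_pos.2 hS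
  rcases hc.eq_or_lt with h1 | h1
  · obtain ⟨b, rfl⟩ := Finset.card_eq_one.1 h1.symm
    simp [faces]
  · have h2 : (0 : ℚ) < 2 * (S.card - 1) := by
      have : (1 : ℚ) < S.card := by exact_mod_cast h1
      linarith
    refine le_of_mul_le_mul_left ?_ h2
    have := G.facesWithin_le hS
    linarith

/-! ### The degree and the number of faces -/

theorem mem_fullCycles [Fintype C] [DecidableEq C] {σ : Equiv.Perm C} :
    σ ∈ fullCycles C ↔ σ.IsCycle ∧ σ.support = Finset.univ := by
  simp [fullCycles]

theorem card_fullCycles [Fintype C] [DecidableEq C] (hC : 2 ≤ Fintype.card C) :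
    (fullCycles C).card = (Fintype.card C - 1).factorial := by
  have h := Equiv.Perm.card_of_cycleType_singleton (α := C) hC le_rfl
  rw [Nat.choose_self, mul_one] at h
  rw [← h]
  congr 1
  ext σ
  rw [mem_fullCycles, Finset.mem_filter]
  simp only [Finset.mem_univ, true_and]
  constructor
  · rintro ⟨h1, h2⟩
    rw [h1.cycleType, h2, Finset.card_univ]
  · intro h
    refine ⟨Equiv.Perm.card_cycleType_eq_one.1 (by rw [h]; simp), ?_⟩
    rw [← Finset.card_eq_iff_eq_univ, ← Equiv.Perm.sum_cycleType, h]
    simp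

/-- Conjugation by the transposition of `x` and `c'` fixes `c` and exchanges the full cycles with `c
↦ x` and those with `c ↦ c'`. The (Δ - 1)! full cycles are therefore spread evenly over the Δ - 1
possible images of `c`. -/
theorem card_fullCycles_apply [Fintype C] [DecidableEq C] {c c' : C} (hc : c ≠ c') :
    ((fullCycles C).filter fun σ => σ c = c').card = (Fintype.card C - 2).factorial := by
  have hC : 2 ≤ Fintype.card C := Fintype.one_lt_card_iff.2 ⟨c, c', hc⟩
  have key : ∀ x, x ≠ c → ((fullCycles C).filter fun σ => σ c = x).card =
      ((fullCycles C).filter fun σ => σ c = c').card := by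
    intro x hx
    set τ := Equiv.swap x c'
    have hτ : τ * τ = 1 := Equiv.swap_mul_self _ _
    have hτ' : τ⁻¹ = τ := Equiv.swap_inv _ _
    have hτc : τ c = c := Equiv.swap_apply_of_ne_of_ne hx.symm hc
    have hmem : ∀ σ ∈ fullCycles C, τ * σ * τ ∈ fullCycles C := by
      intro σ hσ
      rw [mem_fullCycles] at hσ ⊢
      have e : τ * σ * τ = τ * σ * τ⁻¹ := by rw [hτ']
      rw [e]
      refine ⟨hσ.1.conj, ?_⟩
      rw [Equiv.Perm.support_conj, hσ.2, Finset.map_univ_equiv]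
    refine Finset.card_nbij' (fun σ => τ * σ * τ) (fun σ => τ * σ * τ) ?_ ?_ ?_ ?_
    · intro σ hσ
      simp only [Finset.coe_filter, Set.mem_ofPred_eq] at hσ ⊢
      refine ⟨hmem _ hσ.1, ?_⟩
      simp [Equiv.Perm.mul_apply, hτc, hσ.2, τ]
    · intro σ hσ
      simp only [Finset.coe_filter, Set.mem_ofPred_eq] at hσ ⊢
      refine ⟨hmem _ hσ.1, ?_⟩
      simp [Equiv.Perm.mul_apply, hτc, hσ.2, τ]
    · intro σ _
      calc τ * (τ * σ * τ) * τ = (τ * τ) * σ * (τ * τ) := by group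
        _ = σ := by rw [hτ]; simp
    · intro σ _
      calc τ * (τ * σ * τ) * τ = (τ * τ) * σ * (τ * τ) := by group
        _ = σ := by rw [hτ]; simp
  have hzero : ((fullCycles C).filter fun σ => σ c = c).card = 0 := by
    rw [Finset.card_eq_zero, Finset.filter_eq_empty_iff]
    intro σ hσ h
    have : c ∈ σ.support := by rw [(mem_fullCycles.1 hσ).2]; simp
    exact Equiv.Perm.mem_support.1 this h
  have hsum := Finset.card_eq_sum_card_fiberwise (f := fun σ : Equiv.Perm C => σ c)
    (s := fullCycles C) (t := Finset.univ) fun _ _ => Finset.mem_coe.2 (Finset.mem_univ _)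
  rw [card_fullCycles hC, ← Finset.add_sum_erase _ _ (Finset.mem_univ c), hzero, zero_add,
    Finset.sum_congr rfl fun x hx => key x (Finset.ne_of_mem_erase hx), Finset.sum_const,
    Finset.card_erase_of_mem (Finset.mem_univ c), Finset.card_univ, smul_eq_mul] at hsum
  obtain ⟨m, hm⟩ := Nat.exists_eq_add_of_le hC
  rw [hm] at hsum ⊢
  rw [show 2 + m - 1 = m + 1 by omega, Nat.factorial_succ] at hsum
  rw [show 2 + m - 2 = m by omega]
  exact (Nat.eq_of_mul_eq_mul_left (Nat.succ_pos m) hsum).symm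

/-- Every ordered pair of distinct colors is consecutive in the same number (Δ - 2)! of full cycles,
so averaging over the jackets sees all faces equally. -/
theorem sum_jacketFaces [Fintype C] [DecidableEq C] (G : ColoredGraph C W K) :
    ∑ σ ∈ fullCycles C, (G.jacketFaces σ : ℚ) =
      (Fintype.card C - 2).factorial * G.facesWithin Finset.univ := by
  simp only [jacketFaces, Nat.cast_sum]
  rw [Finset.sum_comm, facesWithin,
    sum_offDiag Finset.univ (fun x y => (G.faces x y : ℚ)), Finset.mul_sum]
  refine Finset.sum_congr rfl fun c _ => ?_
  rw [← Finset.sum_fiberwise (fullCycles C) (fun σ => σ c), Finset.mul_sum,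
    ← Finset.add_sum_erase _ _ (Finset.mem_univ c)]
  have h0 : ((fullCycles C).filter fun σ => σ c = c) = ∅ := by
    rw [Finset.filter_eq_empty_iff]
    intro σ hσ h
    have : c ∈ σ.support := by rw [(mem_fullCycles.1 hσ).2]; simp
    exact Equiv.Perm.mem_support.1 this h
  rw [h0, Finset.sum_empty, zero_add]
  refine Finset.sum_congr rfl fun c' hc' => ?_
  rw [Finset.sum_congr rfl (g := fun _ => (G.faces c c' : ℚ)), Finset.sum_const, nsmul_eq_mul,
    card_fullCycles_apply (Finset.ne_of_mem_erase hc').symm]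
  intro σ hσ
  rw [(Finset.mem_filter.1 hσ).2]

/-- Euler's relation summed over the (Δ - 1)! full cycles. The factor 4 collects the 1/2 of the
genus and the 1/2 for the orientation of the cycles. -/
theorem four_mul_connectedDegree [Fintype C] [DecidableEq C] (hC : 2 ≤ Fintype.card C)
    (G : ColoredGraph C W K) :
    4 / ((Fintype.card C - 2).factorial : ℚ) * G.connectedDegree =
      ((Fintype.card C : ℚ) - 1) * (2 + ((Fintype.card C : ℚ) - 2) * Nat.card W) -
        G.facesWithin Finset.univ := by
  have h1 : ∑ σ ∈ fullCycles C, G.jacketGenus σ = (((Fintype.card C - 1).factorial : ℚ) *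
      (2 + ((Fintype.card C : ℚ) - 2) * Nat.card W) -
        (Fintype.card C - 2).factorial * G.facesWithin Finset.univ) / 2 := by
    rw [← sum_jacketFaces, ← card_fullCycles hC, ← nsmul_eq_mul, ← Finset.sum_const,
      ← Finset.sum_sub_distrib, Finset.sum_div]
    refine Finset.sum_congr rfl fun σ _ => ?_
    rw [jacketGenus]
    ring
  obtain ⟨m, hm⟩ := Nat.exists_eq_add_of_le hC
  rw [connectedDegree, h1, hm, show 2 + m - 1 = m + 1 by omega, show 2 + m - 2 = m by omega,
    Nat.factorial_succ]
  have : (m.factorial : ℚ) ≠ 0 := by positivity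
  push_cast
  field_simp
  ring

/-- The white vertices, sorted by components. -/
def whiteEquiv (G : ColoredGraph C W K) :
    (Σ x : G.Component, {w : W // G.skeleton.connectedComponentMk (Sum.inl w) = x}) ≃ W :=
  Equiv.sigmaFiberEquiv fun w => G.skeleton.connectedComponentMk (Sum.inl w)

/-- The black vertices, sorted by components. -/
def blackEquiv (G : ColoredGraph C W K) :
    (Σ x : G.Component, {k : K // G.skeleton.connectedComponentMk (Sum.inr k) = x}) ≃ K :=
  Equiv.sigmaFiberEquiv fun k => G.skeleton.connectedComponentMk (Sum.inr k)

theorem facesWithin_eq_sum_component [Fintype C] [DecidableEq C] [Finite W] [Finite K]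
    (G : ColoredGraph C W K) [Fintype G.Component] (S : Finset C) :
    G.facesWithin S = ∑ x, (G.componentGraph x).facesWithin S := by
  simp only [facesWithin]
  rw [Finset.sum_comm]
  refine Finset.sum_congr rfl fun c _ => ?_
  rw [← Nat.cast_sum]
  congr 1
  exact numComp_eq_sum _ (fun x => (G.componentGraph x).restrict _) G.whiteEquiv G.blackEquiv
    fun c x w => rfl

/-- The number of faces of a graph in terms of its degree. -/
theorem four_mul_degree [Fintype C] [DecidableEq C] [Finite W] [Finite K]
    (hC : 2 ≤ Fintype.card C) (G : ColoredGraph C W K) :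
    4 / ((Fintype.card C - 2).factorial : ℚ) * G.degree =
      2 * ((Fintype.card C : ℚ) - 1) * G.numComp +
        ((Fintype.card C : ℚ) - 1) * ((Fintype.card C : ℚ) - 2) * Nat.card W -
        G.facesWithin Finset.univ := by
  have := Fintype.ofFinite G.Component
  have hW : (Nat.card W : ℚ) = ∑ x : G.Component,
      (Nat.card {w : W // G.skeleton.connectedComponentMk (Sum.inl w) = x} : ℚ) := by
    rw [← Nat.cast_sum, ← Nat.card_sigma, Nat.card_congr G.whiteEquiv]
  rw [degree, finsum_eq_sum_of_fintype, Finset.mul_sum,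
    Finset.sum_congr rfl fun x _ => four_mul_connectedDegree hC (G.componentGraph x),
    facesWithin_eq_sum_component, Finset.sum_sub_distrib, ← Finset.mul_sum,
    Finset.sum_add_distrib, ← Finset.mul_sum, ← hW, Finset.sum_const, numComp,
    Finset.card_univ, nsmul_eq_mul, ← Nat.card_eq_fintype_card (α := G.Component)]
  ring

theorem facesWithin_restrict [DecidableEq C] (G : ColoredGraph C W K) (S : Finset C) :
    (G.restrict S).facesWithin Finset.univ = G.facesWithin S := by
  rw [facesWithin, facesWithin]
  refine Finset.sum_bij (fun x _ => (x.1.1, x.2.1)) ?_ ?_ ?_ ?_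
  · rintro ⟨⟨x, hx⟩, ⟨y, hy⟩⟩ h
    simpa [hx, hy] using h
  · rintro ⟨⟨x, hx⟩, ⟨y, hy⟩⟩ _ ⟨⟨x', hx'⟩, ⟨y', hy'⟩⟩ _ h
    simpa using h
  · rintro ⟨x, y⟩ h
    rw [Finset.mem_offDiag] at h
    exact ⟨(⟨x, h.1⟩, ⟨y, h.2.1⟩), by simpa using h.2.2, rfl⟩
  · rintro ⟨⟨x, hx⟩, ⟨y, hy⟩⟩ _
    have : ((G.restrict S).restrict {⟨x, hx⟩, ⟨y, hy⟩}).skeleton =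
        (G.restrict {x, y}).skeleton := by
      ext u v
      simp [skeleton, restrict]
    rw [faces, faces, numComp, numComp, Component, Component, this]

/-- `four_mul_degree` solved for the faces and expressed in the ambient graph, so that nested color
sets can be compared; it is used for a slice with and without color `0`. -/
theorem facesWithin_eq [DecidableEq C] [Finite W] [Finite K] (G : ColoredGraph C W K)
    {S : Finset C} (hS : 2 ≤ S.card) :
    G.facesWithin S = 2 * ((S.card : ℚ) - 1) * (G.restrict S).numComp +
        ((S.card : ℚ) - 1) * ((S.card : ℚ) - 2) * Nat.card W -
        4 / ((S.card - 2).factorial : ℚ) * (G.restrict S).degree := by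
  have h := four_mul_degree (by simpa using hS) (G.restrict S)
  rw [facesWithin_restrict, Fintype.card_coe] at h
  linarith

end ColoredGraph

/-! ### The slices of a Feynman graph -/

section FeynmanSlices

variable {d L : ℕ} {J : Type}

theorem card_vertices [Fintype J] (B : J → Bubble d) : Nat.card (Vertices B) = ∑ j, (B j).p := by
  simp

/-- Without the lines of color `0` the graph is the disjoint union of its bubbles. -/
theorem numComp_restrict_map_some [Fintype J] (B : J → Bubble d) (φ : Vertices B ≃ Vertices B)
    (D : Finset (Fin d)) :
    ((feynmanGraph B φ).restrict (D.map Function.Embedding.some)).numComp =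
      ∑ j, ((B j).graph.restrict D).numComp := by
  have h1 : ((feynmanGraph B φ).restrict (D.map Function.Embedding.some)).skeleton =
      (⟨fun c : D => (feynmanGraph B φ).line (some c)⟩ :
        ColoredGraph D (Vertices B) (Vertices B)).skeleton := by
    ext x y
    simp [ColoredGraph.skeleton, ColoredGraph.restrict]
  rw [ColoredGraph.numComp, ColoredGraph.Component, h1]
  exact ColoredGraph.numComp_eq_sum _ (fun j => (B j).graph.restrict D) (Equiv.refl _)
    (Equiv.refl _) fun c j w => rfl

theorem facesWithin_map_some [Fintype J] (B : J → Bubble d) (φ : Vertices B ≃ Vertices B)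
    (D : Finset (Fin d)) :
    (feynmanGraph B φ).facesWithin (D.map Function.Embedding.some) =
      ∑ j, (B j).graph.facesWithin D := by
  simp only [ColoredGraph.facesWithin]
  rw [Finset.sum_comm, ColoredGraph.sum_offDiag _ fun x y => ((feynmanGraph B φ).faces x y : ℚ),
    ColoredGraph.sum_offDiag D fun x y => ∑ j, ((B j).graph.faces x y : ℚ), Finset.sum_map]
  refine Finset.sum_congr rfl fun x _ => ?_
  rw [← Finset.map_erase, Finset.sum_map]
  refine Finset.sum_congr rfl fun y _ => ?_
  rw [← Nat.cast_sum]
  congr 1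
  have h := numComp_restrict_map_some B φ {x, y}
  rw [Finset.map_insert, Finset.map_singleton] at h
  exact h

theorem insertNone_eq_insert (D : Finset (Fin d)) :
    Finset.insertNone D = insert none (D.map Function.Embedding.some) := by
  ext x
  cases x <;> simp

theorem none_notMem_map_some (D : Finset (Fin d)) :
    none ∉ D.map Function.Embedding.some := by simp

/-- The exponent of the size of the slice `l` in the amplitude of a Feynman graph, as counted from
the faces. -/
def faceExponent (s : Fin d → Fin L) [Fintype J] (B : J → Bubble d)
    (φ : Vertices B ≃ Vertices B) (l : Fin L) : ℤ :=
  ∑ c ∈ slice s l, ((feynmanGraph B φ).faces none (some c) : ℤ)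
    - ((width s l : ℤ) - 1) * (∑ j, ((B j).p : ℤ) - Fintype.card J)
    - ∑ j, ((bubbleComp s (B j) l : ℤ) - 1)

/-- Half the difference of the face counts of the slice with color `0` (Δ + 1 colors, hence the
factorial of Δ - 1) and without it (Δ colors, factorial of Δ - 2). The degrees combine into Ω_l, and
among the faces only those through color `0` survive. -/
theorem degreePart_eq (s : Fin d → Fin L) [Fintype J] (B : J → Bubble d)
    (φ : Vertices B ≃ Vertices B) (l : Fin L) (hl : 2 ≤ width s l) :
    degreePart s B φ l = (width s l : ℚ) * graphComp s (feynmanGraph B φ) l +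
      ((width s l : ℚ) - 1) * (∑ j, ((B j).p : ℚ) - ∑ j, (bubbleComp s (B j) l : ℚ)) -
      ∑ c ∈ slice s l, ((feynmanGraph B φ).faces none (some c) : ℚ) := by
  have h0 := (feynmanGraph B φ).facesWithin_insert (none_notMem_map_some (slice s l))
  have hc : (insert none ((slice s l).map Function.Embedding.some)).card = width s l + 1 := by
    rw [Finset.card_insert_of_notMem (none_notMem_map_some _), Finset.card_map, width]
  have h1 := (feynmanGraph B φ).facesWithin_eq
    (S := insert none ((slice s l).map Function.Embedding.some)) (by omega)
  have h2 : ∑ j, (B j).graph.facesWithin (slice s l) = 2 * ((width s l : ℚ) - 1) *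
      ∑ j, (bubbleComp s (B j) l : ℚ) + ((width s l : ℚ) - 1) * ((width s l : ℚ) - 2) *
      ∑ j, ((B j).p : ℚ) - 4 / ((width s l - 2).factorial : ℚ) *
      ∑ j, bubbleDegree s (B j) l := by
    rw [Finset.sum_congr rfl fun j _ => (B j).graph.facesWithin_eq hl, Finset.sum_sub_distrib,
      Finset.sum_add_distrib, ← Finset.mul_sum, ← Finset.mul_sum, ← Finset.mul_sum]
    simp only [Nat.card_eq_fintype_card, Fintype.card_fin]
    rfl
  rw [facesWithin_map_some, Finset.sum_map, h1, h2, hc, ← insertNone_eq_insert, card_vertices,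
    show width s l + 1 - 2 = width s l - 1 by omega] at h0
  rw [degreePart, graphDegree, graphComp]
  push_cast at h0
  simp only [Function.Embedding.some_apply] at h0
  linear_combination -h0 / 2

theorem degreePart_nonneg (s : Fin d → Fin L) [Fintype J] (B : J → Bubble d)
    (φ : Vertices B ≃ Vertices B) (l : Fin L) (hl : 2 ≤ width s l) :
    0 ≤ degreePart s B φ l := by
  have h := (feynmanGraph B φ).sum_faces_le (none_notMem_map_some (slice s l))
    (by rw [Finset.map_nonempty, ← Finset.card_pos]; rw [width] at hl; omega)
  rw [degreePart_eq s B φ l hl]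
  rw [Finset.sum_map, numComp_restrict_map_some, ← insertNone_eq_insert, card_vertices,
    Finset.card_map] at h
  simp only [Function.Embedding.some_apply, Nat.cast_sum] at h
  change _ ≤ (width s l : ℚ) * (graphComp s (feynmanGraph B φ) l) + ((width s l : ℚ) - 1) *
    (_ - ∑ j, (bubbleComp s (B j) l : ℚ)) at h
  linarith

theorem exists_nat_eq_degreePart (s : Fin d → Fin L) [Fintype J] (B : J → Bubble d)
    (φ : Vertices B ≃ Vertices B) (l : Fin L) (hl : 2 ≤ width s l) :
    ∃ m : ℕ, (m : ℚ) = degreePart s B φ l := by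
  have h0 := degreePart_nonneg s B φ l hl
  have h : degreePart s B φ l = (((width s l : ℤ) * graphComp s (feynmanGraph B φ) l +
      ((width s l : ℤ) - 1) * (∑ j, ((B j).p : ℤ) - ∑ j, (bubbleComp s (B j) l : ℤ)) -
      ∑ c ∈ slice s l, ((feynmanGraph B φ).faces none (some c) : ℤ) : ℤ) : ℚ) := by
    rw [degreePart_eq s B φ l hl]
    push_cast
    rfl
  rw [h] at h0 ⊢
  obtain ⟨m, hm⟩ := Int.eq_ofNat_of_zero_le (Int.cast_nonneg_iff.1 h0)
  exact ⟨m, by rw [hm]; rfl⟩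

/-- Submodularity for the slice with color `0` and the set of all bubble colors. Their union is the
whole connected graph, their intersection the slice of the bubbles, and the bubble colors alone have
one component per bubble. -/
theorem graphComp_le (s : Fin d → Fin L) [Fintype J] (B : J → Bubble d)
    {φ : Vertices B ≃ Vertices B} (hφ : (feynmanGraph B φ).Connected) (l : Fin L) :
    (graphComp s (feynmanGraph B φ) l : ℤ) ≤ 1 + ∑ j, ((bubbleComp s (B j) l : ℤ) - 1) := by
  have h := (feynmanGraph B φ).numComp_add_le (Finset.insertNone (slice s l))
    (Finset.univ.map Function.Embedding.some)
  have h1 : Finset.insertNone (slice s l) ∪ Finset.univ.map Function.Embedding.some =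
      Finset.univ := by
    ext x; cases x <;> simp
  have h2 : Finset.insertNone (slice s l) ∩ Finset.univ.map Function.Embedding.some =
      (slice s l).map Function.Embedding.some := by
    ext x; cases x <;> simp
  rw [h1, h2, ColoredGraph.numComp_restrict_univ, hφ.numComp_eq_one, numComp_restrict_map_some,
    numComp_restrict_map_some] at h
  simp only [ColoredGraph.numComp_restrict_univ, (Bubble.connected _).numComp_eq_one,
    Finset.sum_const, smul_eq_mul, mul_one] at h
  change graphComp s (feynmanGraph B φ) l + _ ≤ 1 + ∑ j, bubbleComp s (B j) l at h
  rw [Finset.sum_sub_distrib, Finset.sum_const, nsmul_eq_mul, mul_one]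
  have : (graphComp s (feynmanGraph B φ) l : ℤ) + (Finset.univ : Finset J).card ≤
    1 + ∑ j, (bubbleComp s (B j) l : ℤ) := by exact_mod_cast h
  linarith

/-- Inserting `degreePart_eq` cancels `graphComp`, so that the rational exponent becomes the integer
read off from the faces. -/
theorem sliceExponent_eq (s : Fin d → Fin L) [Fintype J] (B : J → Bubble d)
    (φ : Vertices B ≃ Vertices B) (l : Fin L) (hl : 2 ≤ width s l) :
    sliceExponent s B φ l = (faceExponent s B φ l : ℚ) := by
  rw [sliceExponent, degreePart_eq s B φ l hl, faceExponent]
  push_cast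
  simp only [Finset.sum_sub_distrib, Finset.sum_const, nsmul_eq_mul, mul_one, Finset.card_univ]
  ring

theorem sliceExponent_le_sub (s : Fin d → Fin L) [Fintype J] (B : J → Bubble d)
    {φ : Vertices B ≃ Vertices B} (hφ : (feynmanGraph B φ).Connected) (l : Fin L) :
    sliceExponent s B φ l ≤ width s l - degreePart s B φ l := by
  have h := graphComp_le s B hφ l
  have h' : (graphComp s (feynmanGraph B φ) l : ℚ) ≤
    1 + ∑ j, ((bubbleComp s (B j) l : ℚ) - 1) := by exact_mod_cast h
  rw [sliceExponent]
  have : (0 : ℚ) ≤ width s l := by positivity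
  nlinarith

theorem sliceExponent_le (s : Fin d → Fin L) [Fintype J] (B : J → Bubble d)
    {φ : Vertices B ≃ Vertices B} (hφ : (feynmanGraph B φ).Connected) (l : Fin L)
    (hl : 2 ≤ width s l) : sliceExponent s B φ l ≤ width s l := by
  linarith [sliceExponent_le_sub s B hφ l, degreePart_nonneg s B φ l hl]

theorem faceExponent_le (s : Fin d → Fin L) [Fintype J] (B : J → Bubble d)
    {φ : Vertices B ≃ Vertices B} (hφ : (feynmanGraph B φ).Connected) (l : Fin L)
    (hl : 2 ≤ width s l) : faceExponent s B φ l ≤ width s l := by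
  have := sliceExponent_le s B hφ l hl
  rw [sliceExponent_eq s B φ l hl] at this
  exact_mod_cast this

end FeynmanSlices

/-! ### Index sums -/

section IndexSums

variable {d : ℕ} {W K : Type}

/-- Assignments of indices to the white and black vertices that agree along all lines, where a
line of color `0` identifies all the indices at its ends. -/
def Compatible (n : Fin d → ℕ) (G : ColoredGraph (Option (Fin d)) W K) (x : W → Index n)
    (y : K → Index n) : Prop :=
  (∀ v c, x v c = y (G.line (some c) v) c) ∧ ∀ v, x v = y (G.line none v)

/-- Compatible assignments amount to one index for each face of colors `0, c`. -/
def compatibleEquiv (n : Fin d → ℕ) (G : ColoredGraph (Option (Fin d)) W K) :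
    {z : (W → Index n) × (K → Index n) // Compatible n G z.1 z.2} ≃
      ∀ c, {g : W ⊕ K → Fin (n c) // (G.restrict {none, some c}).IsInvariant g} where
  toFun z c := ⟨fun v => v.elim (fun w => z.1.1 w c) (fun k => z.1.2 k c), by
    rw [ColoredGraph.isInvariant_restrict]
    intro a ha w
    simp only [Finset.mem_insert, Finset.mem_singleton] at ha
    rcases ha with rfl | rfl
    · exact congrFun (z.2.2 w) c
    · exact z.2.1 w c⟩
  invFun g := ⟨(fun w c => (g c).1 (Sum.inl w), fun k c => (g c).1 (Sum.inr k)),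
    fun v c => (ColoredGraph.isInvariant_restrict.1 (g c).2) (some c) (by simp) v,
    fun v => funext fun c => (ColoredGraph.isInvariant_restrict.1 (g c).2) none (by simp) v⟩
  left_inv z := rfl
  right_inv g := by
    ext c (w | k) <;> rfl

theorem card_compatible [Finite W] [Finite K] (n : Fin d → ℕ)
    (G : ColoredGraph (Option (Fin d)) W K) :
    Nat.card {z : (W → Index n) × (K → Index n) // Compatible n G z.1 z.2} =
      ∏ c, n c ^ G.faces none (some c) := by
  rw [Nat.card_congr (compatibleEquiv n G), Nat.card_pi]
  refine Finset.prod_congr rfl fun c _ => ?_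
  rw [ColoredGraph.card_invariant, Nat.card_eq_fintype_card, Fintype.card_fin]
  rfl

end IndexSums

/-! ### Gaussian moments -/

section Gaussian

open MeasureTheory ComplexConjugate

theorem integral_norm_pow_mul_gaussian {s : ℝ} (hs : 0 < s) (m : ℕ) :
    ∫ z : ℂ, ‖z‖ ^ m * Real.exp (-s * ‖z‖ ^ 2) =
      Real.pi * s ^ (-((m : ℝ) + 2) / 2) * Real.Gamma (((m : ℝ) + 2) / 2) := by
  have h := Complex.integral_rpow_mul_exp_neg_mul_rpow (p := 2) (q := m) (by norm_num)
    (by linarith [(Nat.cast_nonneg m : (0 : ℝ) ≤ m)]) hs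
  simp only [Real.rpow_natCast, Real.rpow_two] at h
  rw [h]
  ring

/-- The integral of a non-integrable function is 0 by convention, whereas the closed formula gives a
positive value. -/
theorem integrable_norm_pow_mul_gaussian {s : ℝ} (hs : 0 < s) (m : ℕ) :
    Integrable fun z : ℂ => ‖z‖ ^ m * Real.exp (-s * ‖z‖ ^ 2) := by
  by_contra h
  have h1 := integral_norm_pow_mul_gaussian hs m
  rw [integral_undef h] at h1
  have h2 : 0 < Real.Gamma (((m : ℝ) + 2) / 2) := Real.Gamma_pos_of_pos (by positivity)
  have h3 : 0 < Real.pi * s ^ (-((m : ℝ) + 2) / 2) * Real.Gamma (((m : ℝ) + 2) / 2) := by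
    have := Real.pi_pos
    positivity
  linarith

theorem integrable_moment {s : ℝ} (hs : 0 < s) (m n : ℕ) :
    Integrable fun z : ℂ => z ^ m * conj z ^ n * (Real.exp (-s * ‖z‖ ^ 2) : ℂ) := by
  refine (integrable_norm_pow_mul_gaussian hs (m + n)).mono' ?_ (Filter.Eventually.of_forall ?_)
  · exact Continuous.aestronglyMeasurable (by fun_prop)
  · intro z
    rw [norm_mul, norm_mul, norm_pow, norm_pow, RCLike.norm_conj, Complex.norm_real, pow_add,
      Real.norm_of_nonneg (Real.exp_pos _).le]

theorem integral_moment {s : ℝ} (hs : 0 < s) (m n : ℕ) :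
    ∫ z : ℂ, z ^ m * conj z ^ n * (Real.exp (-s * ‖z‖ ^ 2) : ℂ) =
      if m = n then (Real.pi / s : ℂ) * ((s : ℂ)⁻¹ ^ m * (m.factorial : ℂ)) else 0 := by
  split_ifs with h
  · subst h
    have h1 : ∀ z : ℂ, z ^ m * conj z ^ m * (Real.exp (-s * ‖z‖ ^ 2) : ℂ) =
        ((‖z‖ ^ (2 * m) * Real.exp (-s * ‖z‖ ^ 2) : ℝ) : ℂ) := by
      intro z
      rw [← mul_pow, Complex.mul_conj, Complex.normSq_eq_norm_sq, pow_mul]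
      push_cast
      ring
    simp only [h1]
    rw [integral_complex_ofReal, integral_norm_pow_mul_gaussian hs]
    have h2 : ((2 * m : ℕ) + 2 : ℝ) / 2 = m + 1 := by push_cast; ring
    have h3 : -((2 * m : ℕ) + 2 : ℝ) / 2 = -((m + 1 : ℕ) : ℝ) := by push_cast; ring
    rw [h2, h3, Real.Gamma_nat_eq_factorial, Real.rpow_neg hs.le, Real.rpow_natCast, pow_succ]
    push_cast
    rw [mul_inv, inv_pow]
    ring
  · have hmn : (m : ℂ) - n ≠ 0 := by
      rw [sub_ne_zero]; exact_mod_cast h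
    set I := ∫ z : ℂ, z ^ m * conj z ^ n * (Real.exp (-s * ‖z‖ ^ 2) : ℂ) with hI
    -- Rotation by π/(m - n) preserves Lebesgue measure and the Gaussian and multiplies z^m z̄^n by
    -- -1, so the integral equals its own negative.
    let u : Circle := Circle.exp (Real.pi / ((m : ℝ) - n))
    have hu : (u : ℂ) ^ m * conj (u : ℂ) ^ n = -1 := by
      simp only [u, Circle.coe_exp, ← Complex.exp_conj, ← Complex.exp_nat_mul, ← Complex.exp_add]
      rw [← Complex.exp_pi_mul_I]
      congr 1
      simp only [map_mul, Complex.conj_ofReal, Complex.conj_I]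
      push_cast
      field_simp
      ring
    have h1 := (rotation u).measurePreserving.integral_comp
      (rotation u).toHomeomorph.measurableEmbedding
      (fun z : ℂ => z ^ m * conj z ^ n * (Real.exp (-s * ‖z‖ ^ 2) : ℂ))
    have h2 : ∀ z : ℂ, (rotation u z) ^ m * conj (rotation u z) ^ n *
        (Real.exp (-s * ‖rotation u z‖ ^ 2) : ℂ) =
        -(z ^ m * conj z ^ n * (Real.exp (-s * ‖z‖ ^ 2) : ℂ)) := by
      intro z
      rw [LinearIsometryEquiv.norm_map, rotation_apply, map_mul, mul_pow, mul_pow]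
      linear_combination (z ^ m * conj z ^ n * (Real.exp (-s * ‖z‖ ^ 2) : ℂ)) * hu
    simp only [h2] at h1
    rw [integral_neg, ← hI] at h1
    have h4 : (2 : ℂ) * I = 0 := by linear_combination -h1
    simpa using h4

variable {V A : Type} [Fintype V] [Fintype A] [DecidableEq A]

/-- Matchings that respect labels, sorted by the labels. -/
def labelledMatchingEquiv (x y : V → A) :
    {φ : V ≃ V // ∀ v, x v = y (φ v)} ≃ ∀ a, {v // x v = a} ≃ {v // y v = a} where
  toFun φ a := φ.1.subtypeEquiv fun v => by rw [φ.2 v]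
  invFun e := ⟨((Equiv.sigmaFiberEquiv x).symm.trans (Equiv.sigmaCongrRight e)).trans
    (Equiv.sigmaFiberEquiv y), fun v => ((e (x v)) ⟨v, rfl⟩).2.symm⟩
  left_inv φ := by ext v; rfl
  right_inv e := by
    ext a ⟨v, rfl⟩
    rfl

/-- Such a matching is an independent bijection for each label. The resulting product of factorials,
or 0, has the same shape as the product of one-variable moments in `integral_moment`; this
coincidence is Wick's theorem. -/
theorem card_labelledMatching (x y : V → A) :
    Nat.card {φ : V ≃ V // ∀ v, x v = y (φ v)} =
      ∏ a, if (Finset.univ.filter fun v => x v = a).card =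
          (Finset.univ.filter fun v => y v = a).card
        then (Finset.univ.filter fun v => x v = a).card.factorial else 0 := by
  classical
  rw [Nat.card_congr (labelledMatchingEquiv x y), Nat.card_pi]
  refine Finset.prod_congr rfl fun a _ => ?_
  rw [← Fintype.card_subtype, ← Fintype.card_subtype, Nat.card_eq_fintype_card]
  split_ifs with h
  · exact Fintype.card_equiv (Fintype.equivOfCardEq h)
  · rw [Fintype.card_eq_zero_iff]
    exact ⟨fun e => h (Fintype.card_congr e)⟩

theorem monomial_mul_gaussian_eq_prod (s : ℝ) (x y : V → A) (T : A → ℂ) :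
    (∏ v, T (x v)) * (∏ v, conj (T (y v))) * (Real.exp (-s * ∑ a, ‖T a‖ ^ 2) : ℂ) =
      ∏ a, (T a ^ (Finset.univ.filter fun v => x v = a).card *
        conj (T a) ^ (Finset.univ.filter fun v => y v = a).card *
        (Real.exp (-s * ‖T a‖ ^ 2) : ℂ)) := by
  have h : ∀ (z : V → A) (f : A → ℂ),
      ∏ v, f (z v) = ∏ a, f a ^ (Finset.univ.filter fun v => z v = a).card := by
    intro z f
    rw [← Finset.prod_fiberwise Finset.univ z]
    refine Finset.prod_congr rfl fun a _ => ?_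
    rw [Finset.prod_congr rfl (g := fun _ => f a), Finset.prod_const]
    intro v hv
    rw [(Finset.mem_filter.1 hv).2]
  rw [h x T, h y fun a => conj (T a), Finset.mul_sum, Real.exp_sum, Complex.ofReal_prod,
    ← Finset.prod_mul_distrib, ← Finset.prod_mul_distrib]

theorem integrable_monomial {s : ℝ} (hs : 0 < s) (x y : V → A) :
    Integrable fun T : A → ℂ =>
      (∏ v, T (x v)) * (∏ v, conj (T (y v))) * (Real.exp (-s * ∑ a, ‖T a‖ ^ 2) : ℂ) := by
  simp only [monomial_mul_gaussian_eq_prod]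
  exact Integrable.fintype_prod fun a => integrable_moment hs _ _

/-- Wick's theorem for a monomial in the components of a tensor and their conjugates. -/
theorem integral_monomial {s : ℝ} (hs : 0 < s) (x y : V → A) :
    ∫ T : A → ℂ,
      (∏ v, T (x v)) * (∏ v, conj (T (y v))) * (Real.exp (-s * ∑ a, ‖T a‖ ^ 2) : ℂ) =
    (Real.pi / s : ℂ) ^ Fintype.card A * ((s : ℂ)⁻¹ ^ Fintype.card V *
      (Nat.card {φ : V ≃ V // ∀ v, x v = y (φ v)} : ℂ)) := by
  simp only [monomial_mul_gaussian_eq_prod]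
  rw [integral_fintype_prod_volume_eq_prod (fun a z =>
    z ^ (Finset.univ.filter fun v => x v = a).card *
        conj z ^ (Finset.univ.filter fun v => y v = a).card *
        (Real.exp (-s * ‖z‖ ^ 2) : ℂ))]
  simp only [integral_moment hs]
  rw [card_labelledMatching, Nat.cast_prod]
  have h : (s : ℂ)⁻¹ ^ Fintype.card V =
      ∏ a, (s : ℂ)⁻¹ ^ (Finset.univ.filter fun v => x v = a).card := by
    rw [Finset.prod_pow_eq_pow_sum, ← Finset.card_univ,
      Finset.card_eq_sum_card_fiberwise (f := x) (t := Finset.univ)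
        fun _ _ => Finset.mem_coe.2 (Finset.mem_univ _)]
  rw [h, ← Finset.prod_mul_distrib, ← Finset.card_univ, ← Finset.prod_const,
    ← Finset.prod_mul_distrib]
  refine Finset.prod_congr rfl fun a _ => ?_
  split_ifs <;> simp

end Gaussian

/-! ### Wick expansion of products of invariants -/

section Wick

open MeasureTheory ComplexConjugate

variable {d : ℕ} {I J : Type}

/-- The indices at the black vertices, given those at the white vertices. -/
def blackIndex (n : Fin d → ℕ) (B : J → Bubble d) (x : Vertices B → Index n) :
    Vertices B → Index n :=
  fun k c => x ((Equiv.sigmaCongrRight fun j => (B j).graph.line c).symm k) c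

open Classical in
theorem prod_invariant [Fintype J] (n : Fin d → ℕ) (B : J → Bubble d) (T : Index n → ℂ) :
    ∏ j, (B j).invariant n T = ∑ x : Vertices B → Index n,
      (∏ v, T (x v)) * ∏ k, conj (T (blackIndex n B x k)) := by
  simp only [Bubble.invariant]
  rw [Finset.prod_univ_sum, Fintype.piFinset_univ,
    ← (Equiv.piCurry fun (j : J) (_ : Fin (B j).p) => Index n).sum_comp]
  refine Finset.sum_congr rfl fun x _ => ?_
  rw [Finset.prod_mul_distrib, Fintype.prod_sigma, Fintype.prod_sigma]
  rfl

theorem feynmanGraph_line_some (B : J → Bubble d) (φ : Vertices B ≃ Vertices B) (c : Fin d)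
    (v : Vertices B) :
    (feynmanGraph B φ).line (some c) v = Equiv.sigmaCongrRight (fun j => (B j).graph.line c) v :=
  rfl

theorem Compatible.blackIndex_eq {n : Fin d → ℕ} {B : J → Bubble d} {φ : Vertices B ≃ Vertices B}
    {x y : Vertices B → Index n} (h : Compatible n (feynmanGraph B φ) x y) :
    blackIndex n B x = y := by
  funext k c
  have := h.1 ((Equiv.sigmaCongrRight fun j => (B j).graph.line c).symm k) c
  rwa [feynmanGraph_line_some, Equiv.apply_symm_apply] at this

/-- In a Feynman graph a compatible assignment is determined by the indices of the white
vertices. -/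
def whiteCompatibleEquiv (n : Fin d → ℕ) (B : J → Bubble d) (φ : Vertices B ≃ Vertices B) :
    {x : Vertices B → Index n // ∀ v, x v = blackIndex n B x (φ v)} ≃
      {z : (Vertices B → Index n) × (Vertices B → Index n) //
        Compatible n (feynmanGraph B φ) z.1 z.2} where
  toFun x := ⟨(x.1, blackIndex n B x.1), fun v c => by
    simp only [feynmanGraph_line_some, blackIndex, Equiv.symm_apply_apply], fun v => x.2 v⟩
  invFun z := ⟨z.1.1, fun v => by
    rw [z.2.blackIndex_eq]
    exact z.2.2 v⟩
  left_inv x := rfl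
  right_inv z := Subtype.ext (Prod.ext rfl z.2.blackIndex_eq)

/-- The value of a Feynman graph with propagator `z`, apart from the couplings. -/
def graphWeight (n : Fin d → ℕ) (z : ℂ) [Fintype J] (B : J → Bubble d)
    (φ : Vertices B ≃ Vertices B) : ℂ :=
  z ^ (∑ j, (B j).p) * ∏ c, (n c : ℂ) ^ (feynmanGraph B φ).faces none (some c)

open Classical in
/-- Wick's theorem for a product of invariants. -/
theorem gaussianMean_prod_invariant (M : Model d I) (hM : 0 < M.scale) [Fintype J]
    (B : J → Bubble d) :
    M.gaussianMean (fun T => ∏ j, (B j).invariant M.size T) =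
      ∑ φ : Vertices B ≃ Vertices B, graphWeight M.size (M.scale : ℂ)⁻¹ B φ := by
  have hZ : (Real.pi / M.scale : ℂ) ^ Fintype.card (Index M.size) ≠ 0 := by
    have h1 : (Real.pi : ℂ) ≠ 0 := Complex.ofReal_ne_zero.2 Real.pi_ne_zero
    have h2 : (M.scale : ℂ) ≠ 0 := Complex.ofReal_ne_zero.2 hM.ne'
    exact pow_ne_zero _ (div_ne_zero h1 h2)
  have hden : ∫ T, (M.gaussianWeight T : ℂ) =
      (Real.pi / M.scale : ℂ) ^ Fintype.card (Index M.size) := by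
    -- The normalization is the Gaussian integral of the empty monomial.
    have := integral_monomial (V := Empty) hM (fun v => v.elim) (fun v => v.elim : _ → Index M.size)
    simpa [Model.gaussianWeight] using this
  rw [Model.gaussianMean, hden, div_eq_iff hZ, mul_comm]
  simp only [prod_invariant, Finset.sum_mul, Model.gaussianWeight]
  rw [integral_finsetSum _ fun x _ => integrable_monomial hM x (blackIndex M.size B x)]
  simp only [integral_monomial hM, ← Finset.mul_sum]
  congr 1
  have hcard : Fintype.card (Vertices B) = ∑ j, (B j).p := by
    rw [← Nat.card_eq_fintype_card, card_vertices]
  simp only [graphWeight, ← Finset.mul_sum, hcard]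
  congr 1
  have h1 : ∀ x : Vertices B → Index M.size,
      (Nat.card {φ : Vertices B ≃ Vertices B // ∀ v, x v = blackIndex M.size B x (φ v)} : ℂ) =
      ∑ φ : Vertices B ≃ Vertices B,
        if ∀ v, x v = blackIndex M.size B x (φ v) then 1 else 0 := by
    intro x
    rw [Nat.card_eq_fintype_card, Fintype.card_subtype, Finset.sum_boole]
  simp only [h1]
  -- Exchange of summations: instead of counting contractions for given indices, count the indices
  -- compatible with a given contraction, one for each face of colors `0, c`.
  rw [Finset.sum_comm]
  refine Finset.sum_congr rfl fun φ _ => ?_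
  rw [Finset.sum_boole, ← Fintype.card_subtype, ← Nat.card_eq_fintype_card,
    Nat.card_congr (whiteCompatibleEquiv M.size B φ), card_compatible]
  push_cast
  rfl

open Classical in
theorem amplitude_eq [Fintype I] (M : Model d I) (t : I → ℂ) (b : I →₀ ℕ)
    (φ : Vertices (copies M.bubble b) ≃ Vertices (copies M.bubble b)) :
    M.amplitude t b φ = (∏ i, (((M.scale * M.suppression i : ℝ) : ℂ) * t i) ^ b i) *
      graphWeight M.size (M.scale : ℂ)⁻¹ (copies M.bubble b) φ := by
  rw [Model.amplitude]
  congr 1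
  have h : ∀ (x y : Vertices (copies M.bubble b) → Index M.size),
      (∏ v, ∏ c,
        if x v c = y ((feynmanGraph (copies M.bubble b) φ).line (some c) v) c then (1 : ℂ) else 0) *
        ∏ v, M.propagator (x v) (y ((feynmanGraph (copies M.bubble b) φ).line none v)) =
      (M.scale : ℂ)⁻¹ ^ (∑ j, (copies M.bubble b j).p) *
        if Compatible M.size (feynmanGraph (copies M.bubble b) φ) x y then 1 else 0 := by
    intro x y
    simp only [Model.propagator, Finset.prod_ite_zero, Finset.prod_const_one, Finset.mem_univ,
      true_imp_iff, Finset.prod_const, Finset.card_univ]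
    rw [← Nat.card_eq_fintype_card, card_vertices, Compatible]
    split_ifs <;> simp_all
  simp only [h, ← Finset.mul_sum, graphWeight]
  congr 1
  rw [← Fintype.sum_prod_type' (f := fun x y =>
    if Compatible M.size (feynmanGraph (copies M.bubble b) φ) x y then (1 : ℂ) else 0),
    Finset.sum_boole, ← Fintype.card_subtype, ← Nat.card_eq_fintype_card, card_compatible]
  push_cast
  rfl

end Wick

/-! ### Isomorphisms and disjoint unions of colored graphs -/

namespace ColoredGraph

variable {C W K W' K' : Type}

/-- An isomorphism of colored graphs is an isomorphism of their skeletons. -/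
def skeletonIso (G : ColoredGraph C W K) (H : ColoredGraph C W' K') (eW : W ≃ W') (eK : K ≃ K')
    (h : ∀ c w, H.line c (eW w) = eK (G.line c w)) : G.skeleton ≃g H.skeleton where
  toEquiv := Equiv.sumCongr eW eK
  map_rel_iff' := by
    have key : ∀ x y, (∃ c w, Equiv.sumCongr eW eK x = Sum.inl w ∧
        Equiv.sumCongr eW eK y = Sum.inr (H.line c w)) ↔
        ∃ c w, x = Sum.inl w ∧ y = Sum.inr (G.line c w) := by
      intro x y
      constructor
      · rintro ⟨c, w, hx, hy⟩
        obtain ⟨w, rfl⟩ := eW.surjective w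
        refine ⟨c, w, (Equiv.sumCongr eW eK).injective hx, (Equiv.sumCongr eW eK).injective ?_⟩
        rw [hy, h]
        rfl
      · rintro ⟨c, w, rfl, rfl⟩
        exact ⟨c, eW w, rfl, by rw [h]; rfl⟩
    intro x y
    simp only [skeleton, SimpleGraph.fromRel_adj, key, ne_eq, EmbeddingLike.apply_eq_iff_eq]

theorem numComp_congr (G : ColoredGraph C W K) (H : ColoredGraph C W' K') (eW : W ≃ W')
    (eK : K ≃ K') (h : ∀ c w, H.line c (eW w) = eK (G.line c w)) : G.numComp = H.numComp :=
  Nat.card_congr (skeletonIso G H eW eK h).connectedComponentEquiv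

theorem connected_congr (G : ColoredGraph C W K) (H : ColoredGraph C W' K') (eW : W ≃ W')
    (eK : K ≃ K') (h : ∀ c w, H.line c (eW w) = eK (G.line c w)) : G.Connected ↔ H.Connected :=
  (skeletonIso G H eW eK h).connected_iff

theorem numComp_eq_add {W₁ W₂ K₁ K₂ : Type} [Finite W] [Finite K] [Finite W₁] [Finite W₂]
    [Finite K₁] [Finite K₂] (G : ColoredGraph C W K) (G₁ : ColoredGraph C W₁ K₁)
    (G₂ : ColoredGraph C W₂ K₂) (eW : W₁ ⊕ W₂ ≃ W) (eK : K₁ ⊕ K₂ ≃ K)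
    (h₁ : ∀ c w, G.line c (eW (Sum.inl w)) = eK (Sum.inl (G₁.line c w)))
    (h₂ : ∀ c w, G.line c (eW (Sum.inr w)) = eK (Sum.inr (G₂.line c w))) :
    G.numComp = G₁.numComp + G₂.numComp := by
  let E : {g : W ⊕ K → Bool // G.IsInvariant g} ≃
      {g : W₁ ⊕ K₁ → Bool // G₁.IsInvariant g} × {g : W₂ ⊕ K₂ → Bool // G₂.IsInvariant g} :=
    { toFun := fun g => (⟨fun v => g.1 (v.map (fun w => eW (Sum.inl w)) fun k => eK (Sum.inl k)),
          fun c w => by simpa [h₁] using g.2 c (eW (Sum.inl w))⟩,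
        ⟨fun v => g.1 (v.map (fun w => eW (Sum.inr w)) fun k => eK (Sum.inr k)),
          fun c w => by simpa [h₂] using g.2 c (eW (Sum.inr w))⟩)
      invFun := fun f => ⟨fun v => v.elim
          (fun w => (eW.symm w).elim (fun w => f.1.1 (Sum.inl w)) fun w => f.2.1 (Sum.inl w))
          (fun k => (eK.symm k).elim (fun k => f.1.1 (Sum.inr k)) fun k => f.2.1 (Sum.inr k)),
        fun c w => by
          obtain ⟨w | w, rfl⟩ := eW.surjective w
          · simpa [h₁] using f.1.2 c w
          · simpa [h₂] using f.2.2 c w⟩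
      left_inv := fun g => by
        ext (w | k)
        · obtain ⟨w | w, rfl⟩ := eW.surjective w <;> simp
        · obtain ⟨k | k, rfl⟩ := eK.surjective k <;> simp
      right_inv := fun f => by
        refine Prod.ext (Subtype.ext ?_) (Subtype.ext ?_) <;> funext v <;> cases v <;> simp }
  have h1 := Nat.card_congr E
  rw [Nat.card_prod, card_invariant, card_invariant, card_invariant, ← pow_add] at h1
  exact Nat.pow_right_injective (le_of_eq (by simp)) h1

end ColoredGraph

/-! ### Clusters of bubbles -/

section Clusters

variable {d : ℕ} {J : Type}

theorem Bubble.p_pos (B : Bubble d) : 0 < B.p := by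
  obtain ⟨x | x⟩ := B.connected.nonempty <;> exact x.pos

/-- A set of bubbles that no line of color `0` leaves. -/
def IsClosedUnder {B : J → Bubble d} (φ : Vertices B ≃ Vertices B) (A : Finset J) : Prop :=
  ∀ v, v.1 ∈ A ↔ (φ v).1 ∈ A

/-- Bubbles are connected, so an invariant predicate on the vertices is a set of bubbles closed
under the lines of color `0`. -/
theorem connected_iff [Fintype J] {B : J → Bubble d} (φ : Vertices B ≃ Vertices B) (j₀ : J) :
    (feynmanGraph B φ).Connected ↔
      ∀ A : Finset J, IsClosedUnder φ A → j₀ ∈ A → ∀ j, j ∈ A := by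
  classical
  constructor
  · intro h A hA h0 j
    have hinv : (feynmanGraph B φ).IsInvariant
        fun x => Sum.elim (fun v => v.1 ∈ A) (fun v => v.1 ∈ A) x := by
      rintro (_ | c) w
      · exact propext (hA w)
      · rfl
    have := hinv.eq_of_reachable (h.preconnected (Sum.inl ⟨j₀, ⟨0, (B j₀).p_pos⟩⟩)
      (Sum.inl ⟨j, ⟨0, (B j).p_pos⟩⟩))
    simpa [h0] using this
  · intro h
    have : Nonempty (Vertices B ⊕ Vertices B) := ⟨Sum.inl ⟨j₀, ⟨0, (B j₀).p_pos⟩⟩⟩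
    refine ColoredGraph.connected_of_invariant fun g hg => ?_
    let r (j : J) : Prop := g (Sum.inl ⟨j, ⟨0, (B j).p_pos⟩⟩)
    have hr : ∀ x, g x ↔ r (Sum.elim (fun v => v.1) (fun v => v.1) x) := by
      intro x
      have hj : ∀ j, (B j).graph.IsInvariant
          fun x => g (x.map (fun k => ⟨j, k⟩) (fun k => ⟨j, k⟩)) :=
        fun j c w => hg (some c) ⟨j, w⟩
      rcases x with ⟨j, k⟩ | ⟨j, k⟩
      · exact iff_of_eq ((hj j).eq_of_reachable ((B j).connected.preconnected (Sum.inl k)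
          (Sum.inl ⟨0, (B j).p_pos⟩)))
      · exact iff_of_eq ((hj j).eq_of_reachable ((B j).connected.preconnected (Sum.inr k)
          (Sum.inl ⟨0, (B j).p_pos⟩)))
    have hcl : ∀ v, r v.1 ↔ r (φ v).1 := fun v =>
      (hr (Sum.inl v)).symm.trans ((iff_of_eq (hg none v)).trans (hr (Sum.inr (φ v))))
    have hall : ∀ j, r j ↔ r j₀ := by
      intro j
      -- The hypothesis only concerns closed sets containing `j₀`; if `r j₀` fails, it is applied to
      -- the complement.
      by_cases h0 : r j₀
      · have := h (Finset.univ.filter r) (fun v => by simpa using hcl v) (by simpa using h0) j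
        simp only [h0, iff_true]
        simpa using this
      · have := h (Finset.univ.filter fun j => ¬ r j)
          (fun v => by simpa using not_congr (hcl v)) (by simpa using h0) j
        simp only [h0, iff_false]
        simpa using this
    intro x y hx
    rw [hr, hall] at hx ⊢
    exact hx

/-- The bubbles whose label satisfies `P`. -/
def subfamily (B : J → Bubble d) (P : J → Prop) : {j // P j} → Bubble d := fun j => B j

open Classical in
/-- The vertices split along a splitting of the bubbles. -/
def splitVertices (B : J → Bubble d) (P : J → Prop) :
    Vertices (subfamily B P) ⊕ Vertices (subfamily B fun j => ¬ P j) ≃ Vertices B where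
  toFun := Sum.elim (fun v => ⟨v.1.1, v.2⟩) fun v => ⟨v.1.1, v.2⟩
  invFun v := if h : P v.1 then Sum.inl ⟨⟨v.1, h⟩, v.2⟩ else Sum.inr ⟨⟨v.1, h⟩, v.2⟩
  left_inv := by
    rintro (⟨⟨j, hj⟩, k⟩ | ⟨⟨j, hj⟩, k⟩) <;> simp [hj]
  right_inv v := by
    by_cases h : P v.1 <;> simp [h]

/-- Two Wick contractions side by side. -/
def glue {B : J → Bubble d} {P : J → Prop}
    (φ : Vertices (subfamily B P) ≃ Vertices (subfamily B P))
    (ψ : Vertices (subfamily B fun j => ¬ P j) ≃ Vertices (subfamily B fun j => ¬ P j)) :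
    Vertices B ≃ Vertices B :=
  (splitVertices B P).permCongr (Equiv.Perm.sumCongr φ ψ)

section Glue

variable {B : J → Bubble d} {P : J → Prop}
  (φ : Vertices (subfamily B P) ≃ Vertices (subfamily B P))
  (ψ : Vertices (subfamily B fun j => ¬ P j) ≃ Vertices (subfamily B fun j => ¬ P j))

theorem glue_inl (v : Vertices (subfamily B P)) :
    glue φ ψ (splitVertices B P (Sum.inl v)) = splitVertices B P (Sum.inl (φ v)) := by
  simp [glue, Equiv.permCongr_apply]

theorem glue_inr (v : Vertices (subfamily B fun j => ¬ P j)) :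
    glue φ ψ (splitVertices B P (Sum.inr v)) = splitVertices B P (Sum.inr (ψ v)) := by
  simp [glue, Equiv.permCongr_apply]

theorem glue_injective {φ φ' : Vertices (subfamily B P) ≃ Vertices (subfamily B P)}
    {ψ ψ' : Vertices (subfamily B fun j => ¬ P j) ≃ Vertices (subfamily B fun j => ¬ P j)}
    (h : glue φ ψ = glue φ' ψ') : φ = φ' ∧ ψ = ψ' := by
  have h1 := (splitVertices B P).permCongr.injective h
  have h2 : (φ, ψ) = (φ', ψ') := Equiv.Perm.sumCongrHom_injective h1
  exact ⟨congrArg Prod.fst h2, congrArg Prod.snd h2⟩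

/-- A permutation that maps a finite subset into itself permutes it, hence also permutes the
complement; so a one-sided condition suffices. -/
theorem exists_eq_glue [Fintype J] (σ : Vertices B ≃ Vertices B) (h : ∀ v, P v.1 → P (σ v).1) :
    ∃ φ ψ, σ = glue (P := P) φ ψ := by
  have hmem : (splitVertices B P).symm.permCongr σ ∈ (Equiv.Perm.sumCongrHom _ _).range := by
    refine Equiv.Perm.mem_sumCongrHom_range_of_perm_mapsTo_inl ?_
    rintro _ ⟨v, rfl⟩
    rw [Equiv.permCongr_apply, Equiv.symm_symm]
    have hv := h (splitVertices B P (Sum.inl v)) v.1.2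
    refine ⟨⟨⟨(σ (splitVertices B P (Sum.inl v))).1, hv⟩,
      (σ (splitVertices B P (Sum.inl v))).2⟩, ?_⟩
    rw [Equiv.eq_symm_apply]
    rfl
  obtain ⟨⟨φ, ψ⟩, hx⟩ := hmem
  refine ⟨φ, ψ, ?_⟩
  rw [glue]
  change (Equiv.Perm.sumCongr φ ψ) = _ at hx
  rw [hx]
  ext1 v
  simp [Equiv.permCongr_apply]

theorem faces_glue [Fintype J] (c : Fin d) :
    (feynmanGraph B (glue φ ψ)).faces none (some c) =
      (feynmanGraph (subfamily B P) φ).faces none (some c) +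
      (feynmanGraph (subfamily B fun j => ¬ P j) ψ).faces none (some c) := by
  classical
  refine ColoredGraph.numComp_eq_add _ _ _ (splitVertices B P) (splitVertices B P) ?_ ?_
  · rintro ⟨_ | c, hc⟩ w
    · exact glue_inl φ ψ w
    · rfl
  · rintro ⟨_ | c, hc⟩ w
    · exact glue_inr φ ψ w
    · rfl

theorem graphWeight_glue [Fintype J] [Fintype {j // P j}] [Fintype {j // ¬ P j}]
    (n : Fin d → ℕ) (z : ℂ) :
    graphWeight n z B (glue φ ψ) = graphWeight n z (subfamily B P) φ *
      graphWeight n z (subfamily B fun j => ¬ P j) ψ := by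
  classical
  have hp : ∑ j, (B j).p = ∑ j, (subfamily B P j).p + ∑ j, (subfamily B (fun j => ¬ P j) j).p := by
    refine (Fintype.sum_subtype_add_sum_subtype P fun j => (B j).p).symm.trans ?_
    congr 1 <;> exact Finset.sum_congr (by ext; simp) fun _ _ => rfl
  simp only [graphWeight, faces_glue, pow_add, Finset.prod_mul_distrib, hp]
  ring

end Glue

/-- `A` is the set of the bubbles connected to the bubble `j₀`. -/
def IsCluster {B : J → Bubble d} (φ : Vertices B ≃ Vertices B) (j₀ : J) (A : Finset J) : Prop :=
  j₀ ∈ A ∧ IsClosedUnder φ A ∧ ∀ A', IsClosedUnder φ A' → j₀ ∈ A' → A ⊆ A'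

/-- The cluster is the intersection of all closed sets containing `j₀`. -/
theorem existsUnique_isCluster [Fintype J] {B : J → Bubble d} (φ : Vertices B ≃ Vertices B)
    (j₀ : J) : ∃! A, IsCluster φ j₀ A := by
  classical
  refine ⟨Finset.univ.filter fun j => ∀ A', IsClosedUnder φ A' → j₀ ∈ A' → j ∈ A', ⟨?_, ?_, ?_⟩, ?_⟩
  · simp
  · intro v
    simp only [Finset.mem_filter, Finset.mem_univ, true_and]
    exact forall_congr' fun A' => forall_congr' fun h => forall_congr' fun _ => h v
  · intro A' h h0 j hj
    exact (Finset.mem_filter.1 hj).2 A' h h0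
  · rintro A ⟨h0, h1, h2⟩
    ext j
    simp only [Finset.mem_filter, Finset.mem_univ, true_and]
    exact ⟨fun hj A' h h' => h2 A' h h' hj, fun hj => hj A h1 h0⟩

/-- `A` is closed under every glued contraction, so only minimality matters; closed subsets of `A`
depend on `φ` alone, and minimality is the criterion `connected_iff`. -/
theorem isCluster_glue_iff [Fintype J] {B : J → Bubble d} {j₀ : J} {A : Finset J} (h0 : j₀ ∈ A)
    (φ : Vertices (subfamily B (· ∈ A)) ≃ Vertices (subfamily B (· ∈ A)))
    (ψ : Vertices (subfamily B fun j => ¬ j ∈ A) ≃ Vertices (subfamily B fun j => ¬ j ∈ A)) :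
    IsCluster (glue φ ψ) j₀ A ↔ (feynmanGraph (subfamily B (· ∈ A)) φ).Connected := by
  classical
  have hcl : IsClosedUnder (glue φ ψ) A := by
    intro v
    obtain ⟨v | v, rfl⟩ := (splitVertices B (· ∈ A)).surjective v
    · rw [glue_inl]
      exact iff_of_true v.1.2 (φ v).1.2
    · rw [glue_inr]
      exact iff_of_false v.1.2 (ψ v).1.2
  rw [connected_iff φ ⟨j₀, h0⟩]
  constructor
  · rintro ⟨-, -, h⟩ A' hA' h0' j
    have := h (A'.map (Function.Embedding.subtype _)) (fun v => ?_) (by simpa using ⟨h0, h0'⟩) j.2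
    · simpa using this
    · obtain ⟨v | v, rfl⟩ := (splitVertices B (· ∈ A)).surjective v
      · rw [glue_inl]
        have := hA' v
        change (v.1.1 ∈ _) ↔ (φ v).1.1 ∈ _
        simpa using this
      · rw [glue_inr]
        have h1 := v.1.2
        have h2 := (ψ v).1.2
        change (v.1.1 ∈ _) ↔ (ψ v).1.1 ∈ _
        simp [h1, h2]
  · intro h
    refine ⟨h0, hcl, fun A' hA' h0' j hj => ?_⟩
    have := h (Finset.univ.filter fun j => j.1 ∈ A') (fun v => ?_) (by simpa using h0') ⟨j, hj⟩
    · simpa using this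
    · have := hA' (splitVertices B (· ∈ A) (Sum.inl v))
      rw [glue_inl] at this
      change (v.1.1 ∈ A' ↔ (φ v).1.1 ∈ A') at this
      simpa using this

open Classical in
/-- The sum over all Wick contractions. -/
def contractionSum (n : Fin d → ℕ) (z : ℂ) [Fintype J] (B : J → Bubble d) : ℂ :=
  ∑ φ : Vertices B ≃ Vertices B, graphWeight n z B φ

/-- The sum over the connected Wick contractions. -/
def connectedSum (n : Fin d → ℕ) (z : ℂ) [Fintype J] (B : J → Bubble d) : ℂ :=
  ∑ φ ∈ connectedContractions B, graphWeight n z B φ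

theorem mem_connectedContractions [Fintype J] {B : J → Bubble d} {φ : Vertices B ≃ Vertices B} :
    φ ∈ connectedContractions B ↔ (feynmanGraph B φ).Connected := by
  simp [connectedContractions]

/-- Sorting the Wick contractions by the cluster of the bubble `j₀`. -/
theorem contractionSum_eq_sum_cluster (n : Fin d → ℕ) (z : ℂ) [Fintype J] [DecidableEq J]
    (B : J → Bubble d) (j₀ : J) :
    contractionSum n z B = ∑ A ∈ Finset.univ.filter fun A : Finset J => j₀ ∈ A,
      connectedSum n z (subfamily B (· ∈ A)) *
        contractionSum n z (subfamily B fun j => ¬ j ∈ A) := by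
  classical
  -- Since every contraction has exactly one cluster, the indicators of the possible clusters form a
  -- partition of unity.
  have h1 : ∀ φ : Vertices B ≃ Vertices B, graphWeight n z B φ =
      ∑ A : Finset J, if IsCluster φ j₀ A then graphWeight n z B φ else 0 := by
    intro φ
    obtain ⟨A, hA, huniq⟩ := existsUnique_isCluster φ j₀
    rw [Finset.sum_eq_single A, if_pos hA]
    · exact fun A' _ hne => if_neg fun h => hne (huniq A' h)
    · simp
  rw [contractionSum, Finset.sum_congr rfl fun φ _ => h1 φ, Finset.sum_comm, Finset.sum_filter]
  refine Finset.sum_congr rfl fun A _ => ?_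
  split_ifs with h0
  · rw [← Finset.sum_filter, connectedSum, contractionSum, Finset.sum_mul_sum,
      ← Finset.sum_product']
    symm
    refine Finset.sum_bij (fun x _ => glue x.1 x.2) ?_ ?_ ?_ ?_
    · rintro ⟨φ, ψ⟩ h
      rw [Finset.mem_product, mem_connectedContractions] at h
      rw [Finset.mem_filter, isCluster_glue_iff h0]
      exact ⟨@Finset.mem_univ _ (_) _, h.1⟩
    · rintro ⟨φ, ψ⟩ _ ⟨φ', ψ'⟩ _ h
      obtain ⟨rfl, rfl⟩ := glue_injective h
      rfl
    · intro σ hσ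
      rw [Finset.mem_filter] at hσ
      obtain ⟨φ, ψ, rfl⟩ := exists_eq_glue (P := (· ∈ A)) σ fun v hv => (hσ.2.2.1 v).1 hv
      rw [isCluster_glue_iff h0] at hσ
      refine ⟨(φ, ψ), ?_, rfl⟩
      rw [Finset.mem_product, mem_connectedContractions]
      exact ⟨hσ.2, @Finset.mem_univ _ (_) _⟩
    · rintro ⟨φ, ψ⟩ _
      rw [graphWeight_glue]
  · exact Finset.sum_eq_zero fun φ _ => if_neg fun h => h0 h.1

end Clusters

/-! ### Relabelling of bubbles -/

section Relabel

variable {d : ℕ} {J J' : Type}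

theorem relabel_line (e : J ≃ J') (B : J' → Bubble d)
    (φ : Vertices (fun j => B (e j)) ≃ Vertices (fun j => B (e j))) (c : Option (Fin d))
    (w : Vertices fun j => B (e j)) :
    (feynmanGraph B ((Equiv.sigmaCongrLeft (β := fun j => Fin (B j).p) e).permCongr φ)).line c
      (Equiv.sigmaCongrLeft (β := fun j => Fin (B j).p) e w) =
      Equiv.sigmaCongrLeft (β := fun j => Fin (B j).p) e
        ((feynmanGraph (fun j => B (e j)) φ).line c w) := by
  cases c
  · change Equiv.permCongr _ φ _ = _
    rw [Equiv.permCongr_apply, Equiv.symm_apply_apply]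
    rfl
  · rfl

theorem exists_equiv_of_card_fiber_eq [Finite J] [Finite J'] {τ : Type} (f : J → τ) (g : J' → τ)
    (h : ∀ t, Nat.card {x // f x = t} = Nat.card {y // g y = t}) :
    ∃ e : J ≃ J', ∀ x, g (e x) = f x := by
  have hne : ∀ t, Nonempty ({x // f x = t} ≃ {y // g y = t}) :=
    fun t => Finite.card_eq.1 (h t)
  let e := fun t => (hne t).some
  refine ⟨((Equiv.sigmaFiberEquiv f).symm.trans (Equiv.sigmaCongrRight e)).trans
    (Equiv.sigmaFiberEquiv g), fun x => ((e (f x)) ⟨x, rfl⟩).2⟩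

variable [Fintype J] [Fintype J']

theorem graphWeight_relabel (n : Fin d → ℕ) (z : ℂ) (e : J ≃ J') (B : J' → Bubble d)
    (φ : Vertices (fun j => B (e j)) ≃ Vertices (fun j => B (e j))) :
    graphWeight n z B ((Equiv.sigmaCongrLeft (β := fun j => Fin (B j).p) e).permCongr φ) =
      graphWeight n z (fun j => B (e j)) φ := by
  rw [graphWeight, graphWeight, e.sum_comp fun j => (B j).p]
  congr 1
  refine Finset.prod_congr rfl fun c _ => ?_
  congr 1
  exact (ColoredGraph.numComp_congr ((feynmanGraph (fun j => B (e j)) φ).restrict {none, some c})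
    ((feynmanGraph B _).restrict {none, some c}) _ _ fun c w => relabel_line e B φ c w).symm

theorem contractionSum_relabel (n : Fin d → ℕ) (z : ℂ) (e : J ≃ J') (B : J' → Bubble d) :
    contractionSum n z (fun j => B (e j)) = contractionSum n z B := by
  classical
  refine Fintype.sum_equiv (Equiv.sigmaCongrLeft (β := fun j => Fin (B j).p) e).permCongr _ _
    fun φ => (graphWeight_relabel n z e B φ).symm

theorem connectedSum_relabel (n : Fin d → ℕ) (z : ℂ) (e : J ≃ J') (B : J' → Bubble d) :
    connectedSum n z (fun j => B (e j)) = connectedSum n z B := by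
  refine Finset.sum_equiv (Equiv.sigmaCongrLeft (β := fun j => Fin (B j).p) e).permCongr
    (fun φ => ?_) fun φ _ => (graphWeight_relabel n z e B φ).symm
  rw [mem_connectedContractions, mem_connectedContractions]
  exact ColoredGraph.connected_congr _ _ _ _ fun c w => relabel_line e B φ c w

/-- The sum depends only on how many bubbles there are of each kind. This is what lets a subfamily
of labels be replaced by a standard family of copies. -/
theorem contractionSum_congr (n : Fin d → ℕ) (z : ℂ) {τ : Type} (B : τ → Bubble d) (f : J → τ)
    (g : J' → τ) (h : ∀ t, Nat.card {x // f x = t} = Nat.card {y // g y = t}) :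
    contractionSum n z (fun j => B (f j)) = contractionSum n z fun j => B (g j) := by
  obtain ⟨e, he⟩ := exists_equiv_of_card_fiber_eq f g h
  rw [← contractionSum_relabel n z e]
  simp only [he]

theorem connectedSum_congr (n : Fin d → ℕ) (z : ℂ) {τ : Type} (B : τ → Bubble d) (f : J → τ)
    (g : J' → τ) (h : ∀ t, Nat.card {x // f x = t} = Nat.card {y // g y = t}) :
    connectedSum n z (fun j => B (f j)) = connectedSum n z fun j => B (g j) := by
  obtain ⟨e, he⟩ := exists_equiv_of_card_fiber_eq f g h
  rw [← connectedSum_relabel n z e]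
  simp only [he]

end Relabel

/-! ### Counting labelled bubbles -/

section Counting

variable {d : ℕ} {I : Type} (b : I →₀ ℕ)

theorem card_fiber_none (P : Option (Copies b) → Prop) [Decidable (P none)] :
    Nat.card {x : {j // P j} // Option.map Sigma.fst x.1 = none} = if P none then 1 else 0 := by
  split_ifs with h
  · rw [Nat.card_eq_one_iff_unique]
    refine ⟨⟨?_⟩, ⟨⟨⟨none, h⟩, rfl⟩⟩⟩
    rintro ⟨⟨_ | j, hj⟩, h1⟩ ⟨⟨_ | j', hj'⟩, h2⟩
    · rfl
    all_goals simp at h1 h2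
  · have : IsEmpty {x : {j // P j} // Option.map Sigma.fst x.1 = none} := by
      refine ⟨?_⟩
      rintro ⟨⟨_ | j, hj⟩, h1⟩
      · exact h hj
      · simp at h1
    exact Nat.card_of_isEmpty

theorem card_fiber_copies (i : I) : Nat.card {x : Copies b // x.1 = i} = b i := by
  rw [Nat.card_congr (Equiv.sigmaSubtype i)]
  simp

theorem card_fiber_option (o : Option I) :
    Nat.card {x : Option (Copies b) // Option.map Sigma.fst x = o} = o.elim 1 b := by
  cases o with
  | none =>
    have : Unique {x : Option (Copies b) // Option.map Sigma.fst x = none} :=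
      { default := ⟨none, rfl⟩
        uniq := fun x => Subtype.ext (by simpa using x.2) }
    exact Nat.card_unique
  | some i =>
    rw [Option.elim_some, ← card_fiber_copies b i]
    refine Nat.card_congr (Equiv.ofBijective
      (fun x : {x : Copies b // x.1 = i} => ⟨some x.1, by simp [x.2]⟩) ⟨?_, ?_⟩).symm
    · intro x y h
      simpa [Subtype.ext_iff] using h
    · rintro ⟨_ | x, h⟩
      · simp at h
      · exact ⟨⟨x, by simpa using h⟩, rfl⟩

theorem markedCopies_eq (B : I → Bubble d) (i : I) :
    markedCopies (B i) B b = fun j => B (j.elim i Sigma.fst) := by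
  funext j
  cases j <;> rfl

variable [Fintype I]

/-- The number of the labels of each kind that satisfy `P`. -/
def countLabels (P : Option (Copies b) → Prop) : I →₀ ℕ :=
  Finsupp.equivFunOnFinite.symm fun i => Nat.card {k : Fin (b i) // P (some ⟨i, k⟩)}

theorem countLabels_apply (P : Option (Copies b) → Prop) (i : I) :
    countLabels b P i = Nat.card {k : Fin (b i) // P (some ⟨i, k⟩)} := rfl

theorem card_fiber_some (P : Option (Copies b) → Prop) (i : I) :
    Nat.card {x : {j // P j} // Option.map Sigma.fst x.1 = some i} = countLabels b P i := by
  refine Nat.card_congr (Equiv.ofBijective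
    (fun k : {k : Fin (b i) // P (some ⟨i, k⟩)} => ⟨⟨some ⟨i, k.1⟩, k.2⟩, rfl⟩) ⟨?_, ?_⟩).symm
  · rintro ⟨k, hk⟩ ⟨k', hk'⟩ h
    simpa using h
  · rintro ⟨⟨_ | ⟨i', k⟩, hj⟩, h⟩
    · simp at h
    · obtain rfl : i' = i := by simpa using h
      exact ⟨⟨k, hj⟩, rfl⟩

/-- The kinds of bubbles are indexed by `Option I`, with `none` for the mark, so that the mark is
not confused with an ordinary copy of the same bubble. -/
theorem connectedSum_subfamily (n : Fin d → ℕ) (z : ℂ) (B₀ : Bubble d) (B : I → Bubble d)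
    (P : Option (Copies b) → Prop) [Fintype {j // P j}] (h : P none) :
    connectedSum n z (subfamily (markedCopies B₀ B b) P) =
      connectedSum n z (markedCopies B₀ B (countLabels b P)) := by
  classical
  have h1 : ∀ b : I →₀ ℕ, markedCopies B₀ B b =
      fun j => (fun o : Option I => o.elim B₀ B) (Option.map Sigma.fst j) := by
    intro b
    funext j
    cases j <;> rfl
  change connectedSum n z (fun j : {j // P j} => markedCopies B₀ B b j.1) = _
  rw [h1, h1]
  refine connectedSum_congr n z (fun o : Option I => o.elim B₀ B) _ _ fun o => ?_
  rw [card_fiber_option]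
  cases o
  · rw [card_fiber_none, if_pos h]; rfl
  · rw [card_fiber_some]; rfl

theorem contractionSum_subfamily (n : Fin d → ℕ) (z : ℂ) (B₀ : Bubble d) (B : I → Bubble d)
    (P : Option (Copies b) → Prop) [Fintype {j // P j}] (h : ¬ P none) :
    contractionSum n z (subfamily (markedCopies B₀ B b) P) =
      contractionSum n z (copies B (countLabels b P)) := by
  classical
  have h1 : markedCopies B₀ B b =
      fun j => (fun o : Option I => o.elim B₀ B) (Option.map Sigma.fst j) := by
    funext j
    cases j <;> rfl
  have h2 : copies B (countLabels b P) =
      fun j => (fun o : Option I => o.elim B₀ B) (some j.1) := rfl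
  change contractionSum n z (fun j : {j // P j} => markedCopies B₀ B b j.1) = _
  rw [h1, h2]
  refine contractionSum_congr n z (fun o : Option I => o.elim B₀ B) _ _ fun o => ?_
  cases o
  · rw [card_fiber_none, if_neg h]
    simp
  · rw [card_fiber_some]
    simp only [Option.some.injEq]
    rw [card_fiber_copies]

theorem countLabels_add_countLabels_not (P : Option (Copies b) → Prop) :
    countLabels b P + countLabels b (fun j => ¬ P j) = b := by
  classical
  ext i
  rw [Finsupp.add_apply, countLabels_apply, countLabels_apply, Nat.card_eq_fintype_card,
    Nat.card_eq_fintype_card]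
  have := Fintype.card_subtype_compl fun k : Fin (b i) => P (some ⟨i, k⟩)
  have h := Fintype.card_subtype_le fun k : Fin (b i) => P (some ⟨i, k⟩)
  rw [Fintype.card_fin] at this h
  omega

/-- The number of ways to choose labels together with the mark. -/
theorem card_filter_countLabels [DecidableEq I] (b' : I →₀ ℕ) :
    (Finset.univ.filter fun A : Finset (Option (Copies b)) =>
      none ∈ A ∧ countLabels b (· ∈ A) = b').card = ∏ i, (b i).choose (b' i) := by
  have h1 : (Fintype.piFinset fun i =>
      Finset.powersetCard (b' i) (Finset.univ : Finset (Fin (b i)))).card = ∏ i, (b i).choose (b' i) := by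
    rw [Fintype.card_piFinset]
    simp
  rw [← h1]
  have hc : ∀ (A : Finset (Option (Copies b))) i, countLabels b (· ∈ A) i =
      (Finset.univ.filter fun k => some (⟨i, k⟩ : Copies b) ∈ A).card := by
    intro A i
    rw [countLabels_apply, Nat.card_eq_fintype_card, Fintype.card_subtype]
  -- A set of labels containing the mark amounts to an independent choice, for each kind, of a
  -- subset of its copies.
  refine Finset.card_nbij' (fun A i => Finset.univ.filter fun k => some (⟨i, k⟩ : Copies b) ∈ A)
    (fun S => Finset.insertNone (Finset.univ.sigma S)) ?_ ?_ ?_ ?_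
  · intro A hA
    simp only [Finset.coe_filter, Finset.mem_univ, true_and, Set.mem_ofPred_eq] at hA
    simp only [Finset.mem_coe, Fintype.mem_piFinset, Finset.mem_powersetCard]
    exact fun i => ⟨Finset.subset_univ _, by rw [← hc, hA.2]⟩
  · intro S hS
    simp only [Finset.mem_coe, Fintype.mem_piFinset, Finset.mem_powersetCard] at hS
    simp only [Finset.coe_filter, Finset.mem_univ, true_and, Set.mem_ofPred_eq]
    refine ⟨by simp, ?_⟩
    ext i
    rw [hc, ← (hS i).2]
    congr 1
    ext k
    simp
  · intro A hA
    simp only [Finset.coe_filter, Finset.mem_univ, true_and, Set.mem_ofPred_eq] at hA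
    ext j
    cases j
    · simp [hA.1]
    · simp
  · intro S _
    funext i
    ext k
    simp

/-- Sorting the Wick contractions by the number of bubbles of each kind in the component of the
marked bubble. -/
theorem contractionSum_markedCopies [DecidableEq I] (n : Fin d → ℕ) (z : ℂ) (B₀ : Bubble d)
    (B : I → Bubble d) :
    contractionSum n z (markedCopies B₀ B b) = ∑ x ∈ Finset.HasAntidiagonal.antidiagonal b,
      ((∏ i, (b i).choose (x.1 i) : ℕ) : ℂ) * (connectedSum n z (markedCopies B₀ B x.1) *
        contractionSum n z (copies B x.2)) := by
  rw [contractionSum_eq_sum_cluster n z (markedCopies B₀ B b) none]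
  rw [Finset.sum_congr rfl (g := fun A => connectedSum n z (markedCopies B₀ B
    (countLabels b (· ∈ A))) * contractionSum n z (copies B (countLabels b fun j => ¬ j ∈ A)))]
  · rw [← Finset.sum_fiberwise_of_maps_to (t := Finset.HasAntidiagonal.antidiagonal b)
      (g := fun A => (countLabels b (· ∈ A), countLabels b fun j => ¬ j ∈ A))]
    · refine Finset.sum_congr rfl fun x hx => ?_
      rw [← card_filter_countLabels, ← nsmul_eq_mul, ← Finset.sum_const, Finset.filter_filter]
      -- The counts inside and outside the cluster add up to `b`, so fixing the first fixes the
      -- second.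
      have hfilter : (Finset.univ.filter fun A : Finset (Option (Copies b)) => none ∈ A ∧
          (countLabels b (· ∈ A), countLabels b fun j => ¬ j ∈ A) = x) =
          Finset.univ.filter fun A : Finset (Option (Copies b)) =>
            none ∈ A ∧ countLabels b (· ∈ A) = x.1 := by
        ext A
        simp only [Finset.mem_filter, Finset.mem_univ, true_and]
        refine and_congr_right fun _ => ⟨fun h => by rw [← h], fun h => Prod.ext h ?_⟩
        have h1 := countLabels_add_countLabels_not b (· ∈ A)
        rw [h] at h1
        rw [Finset.HasAntidiagonal.mem_antidiagonal, ← h1] at hx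
        exact (add_left_cancel hx).symm
      rw [← hfilter]
      refine Finset.sum_congr rfl fun A hA => ?_
      rw [← (Finset.mem_filter.1 hA).2.2]
    · intro A _
      rw [Finset.HasAntidiagonal.mem_antidiagonal]
      exact countLabels_add_countLabels_not b _
  · intro A hA
    have h0 := (Finset.mem_filter.1 hA).2
    rw [connectedSum_subfamily b n z B₀ B (· ∈ A) h0,
      contractionSum_subfamily b n z B₀ B (fun j => ¬ j ∈ A) (not_not.2 h0)]

/-- Forgetting the mark on a bubble of kind `i` turns it into one more copy of that kind. The two
lemmas that follow use this to read a derivative in t_i as the insertion of a marked bubble. -/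
theorem card_fiber_succ (i j : I) :
    Nat.card {x : Option (Copies b) // (x.elim i Sigma.fst) = j} =
      Nat.card {x : Copies (b + Finsupp.single i 1) // x.1 = j} := by
  classical
  have h := card_fiber_copies b j
  rw [Nat.card_eq_fintype_card, Fintype.card_subtype, Finset.card_filter] at h
  rw [card_fiber_copies, Nat.card_eq_fintype_card, Fintype.card_subtype, Finset.card_filter,
    Fintype.sum_option, Finsupp.add_apply, Finsupp.single_apply, add_comm, ← h]
  rfl

theorem contractionSum_copies_succ (n : Fin d → ℕ) (z : ℂ) (B : I → Bubble d) (i : I) :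
    contractionSum n z (copies B (b + Finsupp.single i 1)) =
      contractionSum n z (markedCopies (B i) B b) := by
  rw [markedCopies_eq]
  exact (contractionSum_congr n z B _ _ fun j => card_fiber_succ b i j).symm

theorem connectedSum_copies_succ (n : Fin d → ℕ) (z : ℂ) (B : I → Bubble d) (i : I) :
    connectedSum n z (copies B (b + Finsupp.single i 1)) =
      connectedSum n z (markedCopies (B i) B b) := by
  rw [markedCopies_eq]
  exact (connectedSum_congr n z B _ _ fun j => card_fiber_succ b i j).symm

/-- A connected graph is nonempty, so the series of connected graphs has no constant term, as log Z
requires. -/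
theorem connectedSum_copies_zero (n : Fin d → ℕ) (z : ℂ) (B : I → Bubble d) :
    connectedSum n z (copies B 0) = 0 := by
  refine Finset.sum_eq_zero fun φ hφ => ?_
  obtain ⟨⟨⟨_, k⟩, _⟩ | ⟨⟨_, k⟩, _⟩⟩ := (mem_connectedContractions.1 hφ).nonempty <;>
    exact k.elim0

/-- The empty graph has one contraction, of weight 1; this gives Z = 1 at zero coupling. -/
theorem contractionSum_copies_zero (n : Fin d → ℕ) (z : ℂ) (B : I → Bubble d) :
    contractionSum n z (copies B 0) = 1 := by
  classical
  have : IsEmpty (Vertices (copies B 0)) := ⟨fun v => v.1.2.elim0⟩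
  have hemp : IsEmpty (Copies (0 : I →₀ ℕ)) := ⟨fun v => v.2.elim0⟩
  have hf : ∀ (φ : Vertices (copies B 0) ≃ Vertices (copies B 0)) c,
      (feynmanGraph (copies B 0) φ).faces none (some c) = 0 := by
    intro φ c
    have : IsEmpty ((feynmanGraph (copies B 0) φ).restrict {none, some c}).Component :=
      ⟨fun x => x.ind fun v => isEmptyElim v⟩
    exact Nat.card_of_isEmpty
  simp [contractionSum, graphWeight, hf]

end Counting

/-! ### The logarithm of a power series in several variables -/

section ChainRule

open PowerSeries in
/-- The chain rule for the substitution of a power series in several variables. -/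
theorem pderiv_subst {σ R : Type*} [CommRing R] (i : σ) (f : PowerSeries R) {a : MvPowerSeries σ R}
    (ha : MvPowerSeries.constantCoeff a = 0) :
    MvPowerSeries.pderiv R i (f.subst a) =
      (derivative R f).subst a * MvPowerSeries.pderiv R i a := by
  classical
  have hs : HasSubst a := HasSubst.of_constantCoeff_zero ha
  -- `a` has no constant term, so `a ^ k` has order at least `k` and each coefficient of a
  -- substitution sees only a truncation of `f`. This reduces the chain rule to polynomials, where
  -- it holds for any derivation.
  have hpow : ∀ (e : σ →₀ ℕ) (k : ℕ), e.degree < k → MvPowerSeries.coeff e (a ^ k) = 0 := by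
    intro e k hk
    refine MvPowerSeries.coeff_of_lt_order (lt_of_lt_of_le (Nat.cast_lt.2 hk) ?_)
    have h1 : (1 : ℕ∞) ≤ a.order := by
      rw [MvPowerSeries.one_le_order_iff_constCoeff_eq_zero]
      exact ha
    calc (k : ℕ∞) = k • (1 : ℕ∞) := by simp
      _ ≤ k • a.order := nsmul_le_nsmul_right h1 k
      _ ≤ (a ^ k).order := MvPowerSeries.le_order_pow k
  have hpoly : ∀ p : Polynomial R, MvPowerSeries.pderiv R i ((p : PowerSeries R).subst a) =
      (derivative R (p : PowerSeries R)).subst a * MvPowerSeries.pderiv R i a := by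
    intro p
    rw [derivative_coe, subst_coe hs, subst_coe hs,
      Derivation.comp_aeval_eq (a := a) (MvPowerSeries.pderiv R i) p, smul_eq_mul]
  ext e
  -- The coefficient `e` of a partial derivative comes from a coefficient of degree one higher, so
  -- `f` is needed up to the power `m` included, hence `trunc (m + 1)`.
  let m := e.degree + 1
  have h1 : ∀ e' : σ →₀ ℕ, e'.degree ≤ m → MvPowerSeries.coeff e' (f.subst a) =
      MvPowerSeries.coeff e' ((trunc (m + 1) f : PowerSeries R).subst a) := by
    intro e' he'
    rw [coeff_subst hs, coeff_subst hs]
    refine finsum_congr fun k => ?_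
    rcases lt_or_ge k (m + 1) with hk | hk
    · rw [coeff_coe_trunc_of_lt hk]
    · rw [hpow e' k (by omega), smul_zero, smul_zero]
  have h2 : ∀ e' : σ →₀ ℕ, e'.degree < m → MvPowerSeries.coeff e' ((derivative R f).subst a) =
      MvPowerSeries.coeff e' ((derivative R (trunc (m + 1) f : PowerSeries R)).subst a) := by
    intro e' he'
    rw [coeff_subst hs, coeff_subst hs]
    refine finsum_congr fun k => ?_
    rcases lt_or_ge k m with hk | hk
    · rw [coeff_derivative, coeff_derivative, coeff_coe_trunc_of_lt (by omega)]
    · rw [hpow e' k (by omega), smul_zero, smul_zero]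
  rw [MvPowerSeries.coeff_pderiv, h1 _ (by simp [m]), ← MvPowerSeries.coeff_pderiv, hpoly,
    MvPowerSeries.coeff_mul, MvPowerSeries.coeff_mul]
  refine Finset.sum_congr rfl fun x hx => ?_
  rw [h2]
  have hdeg := congrArg Finsupp.degree (Finset.HasAntidiagonal.mem_antidiagonal.1 hx)
  rw [map_add] at hdeg
  omega

open PowerSeries in
theorem derivative_log_mul : derivative ℂ (log ℂ) * (1 + X) = 1 := by
  rw [deriv_log]
  ext k
  cases k with
  | zero => simp
  | succ k => simp [mul_add, coeff_succ_mul_X, coeff_one, pow_succ]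

/-- The logarithmic derivative ∂(log Z) = ∂Z / Z, multiplied by Z to avoid the inverse. The argument
is `Z - 1` because `PowerSeries.log` is the expansion of log(1 + X). -/
theorem pderiv_log_subst_mul {σ : Type*} (i : σ) {Z : MvPowerSeries σ ℂ}
    (hZ : MvPowerSeries.constantCoeff Z = 1) :
    MvPowerSeries.pderiv ℂ i ((PowerSeries.log ℂ).subst (Z - 1)) * Z =
      MvPowerSeries.pderiv ℂ i Z := by
  have h0 : MvPowerSeries.constantCoeff (Z - 1) = 0 := by simp [hZ]
  have hs := PowerSeries.HasSubst.of_constantCoeff_zero h0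
  rw [pderiv_subst i _ h0]
  have h1 : (PowerSeries.derivative ℂ (PowerSeries.log ℂ)).subst (Z - 1) * Z = 1 := by
    have h2 : ((1 + PowerSeries.X : PowerSeries ℂ)).subst (Z - 1) = Z := by
      rw [PowerSeries.subst_add hs, PowerSeries.subst_X hs, ← PowerSeries.coe_substAlgHom hs,
        map_one]
      ring
    calc _ = (PowerSeries.derivative ℂ (PowerSeries.log ℂ)).subst (Z - 1) *
          ((1 + PowerSeries.X : PowerSeries ℂ)).subst (Z - 1) := by rw [h2]
      _ = 1 := by
        rw [← PowerSeries.subst_mul hs, derivative_log_mul, ← PowerSeries.coe_substAlgHom hs,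
          map_one]
  rw [mul_right_comm, h1, one_mul, map_sub, MvPowerSeries.pderiv_one, sub_zero]

end ChainRule

/-! ### Perturbative expansions -/

namespace Model

variable {d : ℕ} {I : Type} [Fintype I] (M : Model d I)

/-- The factor of the term of type `b` in a perturbative expansion. -/
def couplingFactor (b : I →₀ ℕ) : ℂ :=
  ∏ i, ((-(M.scale * M.suppression i : ℝ) : ℂ) ^ b i / (Nat.factorial (b i) : ℂ))

/-- The generating series of the connected Feynman graphs. -/
def connectedSeries : MvPowerSeries I ℂ :=
  fun b => M.couplingFactor b * connectedSum M.size (M.scale : ℂ)⁻¹ (copies M.bubble b)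

/-- The generating series of the connected Feynman graphs with a marked bubble. -/
def markedSeries (B₀ : Bubble d) : MvPowerSeries I ℂ :=
  fun b => M.couplingFactor b * connectedSum M.size (M.scale : ℂ)⁻¹ (markedCopies B₀ M.bubble b)

theorem coeff_connectedSeries (b : I →₀ ℕ) : MvPowerSeries.coeff b M.connectedSeries =
    M.couplingFactor b * connectedSum M.size (M.scale : ℂ)⁻¹ (copies M.bubble b) := rfl

theorem coeff_markedSeries (B₀ : Bubble d) (b : I →₀ ℕ) :
    MvPowerSeries.coeff b (M.markedSeries B₀) = M.couplingFactor b *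
      connectedSum M.size (M.scale : ℂ)⁻¹ (markedCopies B₀ M.bubble b) := rfl

theorem coeff_partitionFunction (hM : 0 < M.scale) (b : I →₀ ℕ) :
    MvPowerSeries.coeff b M.partitionFunction = M.couplingFactor b *
      contractionSum M.size (M.scale : ℂ)⁻¹ (copies M.bubble b) := by
  rw [contractionSum, ← gaussianMean_prod_invariant M hM]
  change M.couplingFactor b * _ = _
  congr 2
  funext T
  rw [Fintype.prod_sigma, one_mul]
  refine Finset.prod_congr rfl fun i _ => ?_
  simp [copies]

theorem coeff_perturbative_invariant (hM : 0 < M.scale) (B₀ : Bubble d) (b : I →₀ ℕ) :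
    MvPowerSeries.coeff b (M.perturbative fun T => B₀.invariant M.size T) = M.couplingFactor b *
      contractionSum M.size (M.scale : ℂ)⁻¹ (markedCopies B₀ M.bubble b) := by
  rw [contractionSum, ← gaussianMean_prod_invariant M hM]
  change M.couplingFactor b * _ = _
  congr 2
  funext T
  rw [Fintype.prod_option, Fintype.prod_sigma]
  congr 1
  refine Finset.prod_congr rfl fun i _ => ?_
  simp [copies, markedCopies]

/-- The identity 1/(b! c!) = binom(b + c, b)/(b + c)! absorbs the choice of labels in the cluster,
turning the sum over clusters into a product of power series. -/
theorem couplingFactor_add (b c : I →₀ ℕ) :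
    M.couplingFactor b * M.couplingFactor c =
      M.couplingFactor (b + c) * ((∏ i, ((b + c) i).choose (b i) : ℕ) : ℂ) := by
  rw [couplingFactor, couplingFactor, couplingFactor, Nat.cast_prod, ← Finset.prod_mul_distrib,
    ← Finset.prod_mul_distrib]
  refine Finset.prod_congr rfl fun i _ => ?_
  have h := Nat.add_choose_mul_factorial_mul_factorial (b i) (c i)
  rw [Finsupp.add_apply, Nat.choose_symm_add, ← h, pow_add]
  have h1 : ((b i).factorial : ℂ) ≠ 0 := Nat.cast_ne_zero.2 (Nat.factorial_ne_zero _)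
  have h2 : ((c i).factorial : ℂ) ≠ 0 := Nat.cast_ne_zero.2 (Nat.factorial_ne_zero _)
  have h3 : ((b i + c i).choose (c i) : ℂ) ≠ 0 :=
    Nat.cast_ne_zero.2 (Nat.choose_pos (Nat.le_add_left _ _)).ne'
  push_cast
  field_simp

theorem couplingFactor_succ (b : I →₀ ℕ) (i : I) :
    M.couplingFactor (b + Finsupp.single i 1) * ((b i : ℂ) + 1) =
      -(M.scale * M.suppression i : ℝ) * M.couplingFactor b := by
  classical
  rw [couplingFactor, couplingFactor, ← Finset.mul_prod_erase _ _ (Finset.mem_univ i),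
    ← Finset.mul_prod_erase (a := i) Finset.univ (fun i =>
      ((-(M.scale * M.suppression i : ℝ) : ℂ) ^ b i / (Nat.factorial (b i) : ℂ)))
      (Finset.mem_univ i)]
  have h : ∀ j ∈ Finset.univ.erase i, (b + Finsupp.single i 1 : I →₀ ℕ) j = b j := by
    intro j hj
    simp [(Finset.ne_of_mem_erase hj).symm]
  rw [Finset.prod_congr rfl fun j hj => by rw [h j hj], Finsupp.add_apply, Finsupp.single_eq_same,
    Nat.factorial_succ, pow_succ]
  have h1 : ((b i).factorial : ℂ) ≠ 0 := Nat.cast_ne_zero.2 (Nat.factorial_ne_zero _)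
  have h2 : (b i : ℂ) + 1 ≠ 0 := by exact_mod_cast Nat.succ_ne_zero (b i)
  push_cast
  field_simp

/-- A graph with a marked bubble is the connected component of the mark and another graph. -/
theorem perturbative_invariant_eq_mul (hM : 0 < M.scale) (B₀ : Bubble d) :
    (M.perturbative fun T => B₀.invariant M.size T) = M.markedSeries B₀ * M.partitionFunction := by
  classical
  ext b
  rw [coeff_perturbative_invariant M hM, MvPowerSeries.coeff_mul, contractionSum_markedCopies,
    Finset.mul_sum]
  refine Finset.sum_congr rfl fun x hx => ?_
  rw [coeff_markedSeries, coeff_partitionFunction M hM]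
  have h := M.couplingFactor_add x.1 x.2
  rw [Finset.HasAntidiagonal.mem_antidiagonal.1 hx] at h
  linear_combination -(connectedSum M.size (M.scale : ℂ)⁻¹ (markedCopies B₀ M.bubble x.1) *
    contractionSum M.size (M.scale : ℂ)⁻¹ (copies M.bubble x.2)) * h

theorem constantCoeff_partitionFunction (hM : 0 < M.scale) :
    MvPowerSeries.constantCoeff M.partitionFunction = 1 := by
  rw [← MvPowerSeries.coeff_zero_eq_constantCoeff_apply, coeff_partitionFunction M hM,
    contractionSum_copies_zero]
  simp [couplingFactor]

/-- The partition function accounts for all components away from the mark, and the normalization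
removes it. -/
theorem expectation_eq (hM : 0 < M.scale) (B₀ : Bubble d) :
    M.expectation B₀ = M.markedSeries B₀ := by
  rw [expectation, perturbative_invariant_eq_mul M hM, mul_assoc, MvPowerSeries.mul_inv_cancel,
    mul_one]
  rw [constantCoeff_partitionFunction M hM]
  exact one_ne_zero

theorem pderiv_partitionFunction (hM : 0 < M.scale) (i : I) :
    MvPowerSeries.pderiv ℂ i M.partitionFunction = MvPowerSeries.C
      (-(M.scale * M.suppression i : ℝ) : ℂ) * M.perturbative
        (fun T => (M.bubble i).invariant M.size T) := by
  ext b
  rw [MvPowerSeries.coeff_pderiv, coeff_partitionFunction M hM, MvPowerSeries.coeff_C_mul,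
    coeff_perturbative_invariant M hM, contractionSum_copies_succ]
  linear_combination contractionSum M.size (M.scale : ℂ)⁻¹ (markedCopies (M.bubble i) M.bubble b) *
    M.couplingFactor_succ b i

theorem pderiv_connectedSeries (i : I) :
    MvPowerSeries.pderiv ℂ i M.connectedSeries = MvPowerSeries.C
      (-(M.scale * M.suppression i : ℝ) : ℂ) * M.markedSeries (M.bubble i) := by
  ext b
  rw [MvPowerSeries.coeff_pderiv, coeff_connectedSeries, MvPowerSeries.coeff_C_mul,
    coeff_markedSeries, connectedSum_copies_succ]
  linear_combination connectedSum M.size (M.scale : ℂ)⁻¹ (markedCopies (M.bubble i) M.bubble b) *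
    M.couplingFactor_succ b i

/-- The linked cluster theorem: the free energy counts the connected graphs. -/
theorem freeEnergy_eq (hM : 0 < M.scale) : M.freeEnergy = -M.connectedSeries := by
  have hZ := M.constantCoeff_partitionFunction hM
  have h0 : MvPowerSeries.constantCoeff (M.partitionFunction - 1) = 0 := by simp [hZ]
  rw [freeEnergy]
  congr 1
  -- Over ℂ a power series is determined by its partial derivatives and its constant term. Both
  -- derivatives, multiplied by Z, give the insertion of a marked bubble `i`, and Z can be
  -- cancelled.
  refine MvPowerSeries.pderiv.ext (fun i => ?_) ?_
  · have hne : M.partitionFunction ≠ 0 := fun h => by simp [h] at hZ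
    refine mul_right_cancel₀ hne ?_
    rw [pderiv_log_subst_mul i hZ, pderiv_partitionFunction M hM, pderiv_connectedSeries,
      perturbative_invariant_eq_mul M hM, mul_assoc]
  · rw [PowerSeries.constantCoeff_subst_eq_zero h0 _ PowerSeries.constantCoeff_log,
      ← MvPowerSeries.coeff_zero_eq_constantCoeff_apply, coeff_connectedSeries,
      connectedSum_copies_zero, mul_zero]

end Model

/-! ### Powers of the sizes -/

section Powers

theorem prod_zpow_eq_zpow_sum {ι F : Type*} [CommGroupWithZero F] (S : Finset ι) {x : F}
    (hx : x ≠ 0) (f : ι → ℤ) : ∏ i ∈ S, x ^ f i = x ^ ∑ i ∈ S, f i := by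
  classical
  induction S using Finset.induction_on with
  | empty => simp
  | insert a S ha ih => rw [Finset.prod_insert ha, Finset.sum_insert ha, zpow_add₀ hx, ih]

variable {d L : ℕ} {I J : Type}

theorem sum_width (s : Fin d → Fin L) : ∑ l, width s l = d := by
  have h := Finset.card_eq_sum_card_fiberwise (f := s) (s := Finset.univ) (t := Finset.univ)
    fun _ _ => Finset.mem_coe.2 (Finset.mem_univ _)
  rw [Finset.card_univ, Fintype.card_fin] at h
  exact h.symm

theorem sum_slice {R : Type*} [AddCommMonoid R] (s : Fin d → Fin L) (f : Fin d → R) :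
    ∑ l, ∑ c ∈ slice s l, f c = ∑ c, f c :=
  Finset.sum_fiberwise Finset.univ s f

theorem sum_copies {R : Type*} [CommSemiring R] [Fintype I] (B : I → Bubble d) (b : I →₀ ℕ)
    (g : Bubble d → R) : ∑ j, g (copies B b j) = ∑ i, (b i : R) * g (B i) := by
  rw [Fintype.sum_sigma]
  simp [copies]

theorem card_copies [Fintype I] (b : I →₀ ℕ) : Fintype.card (Copies b) = ∑ i, b i := by
  simp

theorem faceExponent_copies [Fintype I] (s : Fin d → Fin L) (B : I → Bubble d) (b : I →₀ ℕ)
    (φ : Vertices (copies B b) ≃ Vertices (copies B b)) (l : Fin L) :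
    faceExponent s (copies B b) φ l =
      (∑ c ∈ slice s l, ((feynmanGraph (copies B b) φ).faces none (some c) : ℤ))
        - ((width s l : ℤ) - 1) * (∑ i, (b i : ℤ) * ((B i).p : ℤ) - ∑ i, (b i : ℤ))
        - ∑ i, (b i : ℤ) * ((bubbleComp s (B i) l : ℤ) - 1) := by
  rw [faceExponent, card_copies, sum_copies B b fun B => ((B.p : ℕ) : ℤ),
    sum_copies B b fun B => (bubbleComp s B l : ℤ) - 1]
  push_cast
  rfl

theorem degreePart_copies [Fintype I] (s : Fin d → Fin L) (B : I → Bubble d) (b : I →₀ ℕ)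
    (φ : Vertices (copies B b) ≃ Vertices (copies B b)) (l : Fin L) :
    degreePart s (copies B b) φ l =
      2 / (Nat.factorial (width s l - 1) : ℚ) * graphDegree s (feynmanGraph (copies B b) φ) l
        - 2 / (Nat.factorial (width s l - 2) : ℚ) * ∑ i, (b i : ℚ) * bubbleDegree s (B i) l := by
  rw [degreePart, sum_copies B b fun B => bubbleDegree s B l]

/-- The factor of a bubble in an amplitude, without its coupling. -/
def bubbleFactor (s : Fin d → Fin L) (N : Fin L → ℕ) (B : Bubble d) : ℂ :=
  ∏ l, (N l : ℂ) ^ ((width s l : ℤ) - bubbleComp s B l)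

theorem scale_mul_suppression (s : Fin d → Fin L) (B : I → Bubble d) {N : Fin L → ℕ}
    (hN : ∀ l, 1 ≤ N l) (i : I) :
    (((rectangularModel s B N).scale * (rectangularModel s B N).suppression i : ℝ) : ℂ) =
      bubbleFactor s N (B i) := by
  simp only [rectangularModel, bubbleFactor]
  push_cast
  rw [← Finset.prod_mul_distrib]
  refine Finset.prod_congr rfl fun l _ => ?_
  rw [← zpow_add₀ (Nat.cast_ne_zero.2 (Nat.one_le_iff_ne_zero.1 (hN l)))]
  congr 1
  ring

theorem scale_pos (s : Fin d → Fin L) (B : I → Bubble d) {N : Fin L → ℕ} (hN : ∀ l, 1 ≤ N l) :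
    0 < (rectangularModel s B N).scale := by
  have h : ∀ l, (0 : ℝ) < N l := fun l => by exact_mod_cast hN l
  change 0 < ∏ l, (N l : ℝ) ^ ((width s l : ℤ) - 1)
  exact Finset.prod_pos fun l _ => zpow_pos (h l) _

/-- The amplitude of a Feynman graph, without the couplings. -/
theorem graphWeight_mul_prod [Fintype J] (s : Fin d → Fin L) (B : I → Bubble d) {N : Fin L → ℕ}
    (hN : ∀ l, 1 ≤ N l) (B' : J → Bubble d) (φ : Vertices B' ≃ Vertices B') :
    (∏ j, bubbleFactor s N (B' j)) * graphWeight (rectangularModel s B N).size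
      ((rectangularModel s B N).scale : ℂ)⁻¹ B' φ =
      ∏ l, (N l : ℂ) ^ faceExponent s B' φ l := by
  have hN0 : ∀ l, (N l : ℂ) ≠ 0 := fun l => Nat.cast_ne_zero.2 (Nat.one_le_iff_ne_zero.1 (hN l))
  have h1 : ∏ c, (((rectangularModel s B N).size c : ℕ) : ℂ) ^
      (feynmanGraph B' φ).faces none (some c) =
      ∏ l, (N l : ℂ) ^ (∑ c ∈ slice s l, ((feynmanGraph B' φ).faces none (some c) : ℤ)) := by
    rw [← Finset.prod_fiberwise Finset.univ s]
    refine Finset.prod_congr rfl fun l _ => ?_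
    rw [← prod_zpow_eq_zpow_sum _ (hN0 l)]
    refine Finset.prod_congr rfl fun c hc => ?_
    have : s c = l := (Finset.mem_filter.1 hc).2
    rw [zpow_natCast, ← this]
    rfl
  have h2 : ((rectangularModel s B N).scale : ℂ)⁻¹ ^ (∑ j, (B' j).p) =
      ∏ l, (N l : ℂ) ^ (-(((width s l : ℤ) - 1) * ∑ j, ((B' j).p : ℤ))) := by
    simp only [rectangularModel]
    push_cast
    rw [← Finset.prod_inv_distrib, ← Finset.prod_pow]
    refine Finset.prod_congr rfl fun l _ => ?_
    rw [← zpow_neg, ← zpow_natCast, ← zpow_mul]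
    congr 1
    push_cast
    ring
  have h3 : ∏ j, bubbleFactor s N (B' j) =
      ∏ l, (N l : ℂ) ^ ∑ j, ((width s l : ℤ) - bubbleComp s (B' j) l) := by
    simp only [bubbleFactor]
    rw [Finset.prod_comm]
    exact Finset.prod_congr rfl fun l _ => prod_zpow_eq_zpow_sum _ (hN0 l) _
  rw [graphWeight, h1, h2, h3, ← Finset.prod_mul_distrib, ← Finset.prod_mul_distrib]
  refine Finset.prod_congr rfl fun l _ => ?_
  -- The exponent gathers the faces, -(Δ_l - 1) for each propagator and Δ_l - n(B_j^(l)) = (Δ_l - 1)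
  -- - (n(B_j^(l)) - 1) for each bubble.
  rw [← zpow_add₀ (hN0 l), ← zpow_add₀ (hN0 l), faceExponent]
  congr 1
  simp only [Finset.sum_sub_distrib, Finset.sum_const, nsmul_eq_mul, Finset.card_univ, mul_one]
  ring

theorem prod_copies [Fintype I] {R : Type*} [CommMonoid R] (B : I → Bubble d) (b : I →₀ ℕ)
    (g : Bubble d → R) : ∏ j, g (copies B b j) = ∏ i, g (B i) ^ b i := by
  rw [Fintype.prod_sigma]
  simp [copies]

theorem rectangular_amplitude [Fintype I] (s : Fin d → Fin L) (B : I → Bubble d) {N : Fin L → ℕ}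
    (hN : ∀ l, 1 ≤ N l) (t : I → ℂ) (b : I →₀ ℕ)
    (φ : Vertices (copies B b) ≃ Vertices (copies B b)) :
    (rectangularModel s B N).amplitude t b φ =
      (∏ l, (N l : ℂ) ^ faceExponent s (copies B b) φ l) * ∏ i, t i ^ b i := by
  refine (amplitude_eq (rectangularModel s B N) t b φ).trans ?_
  rw [← graphWeight_mul_prod s B hN (copies B b) φ, prod_copies B b (bubbleFactor s N)]
  simp only [scale_mul_suppression s B hN, mul_pow, Finset.prod_mul_distrib]
  rw [mul_right_comm]
  rfl

theorem rpow_sliceExponent [Fintype J] (s : Fin d → Fin L) (hs : ∀ l, 2 ≤ width s l)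
    (B : J → Bubble d) (φ : Vertices B ≃ Vertices B) (N : Fin L → ℕ) (l : Fin L) :
    (N l : ℝ) ^ ((sliceExponent s B φ l : ℚ) : ℝ) = (N l : ℝ) ^ faceExponent s B φ l := by
  rw [sliceExponent_eq s B φ l (hs l), Rat.cast_intCast, Real.rpow_intCast]

theorem norm_rectangular_amplitude [Fintype I] (s : Fin d → Fin L) (hs : ∀ l, 2 ≤ width s l)
    (B : I → Bubble d) {N : Fin L → ℕ} (hN : ∀ l, 1 ≤ N l) (t : I → ℂ) (b : I →₀ ℕ)
    (φ : Vertices (copies B b) ≃ Vertices (copies B b)) :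
    ‖(rectangularModel s B N).amplitude t b φ‖ = ‖∏ i, t i ^ b i‖ *
      ∏ l, (N l : ℝ) ^ ((sliceExponent s (copies B b) φ l : ℚ) : ℝ) := by
  rw [rectangular_amplitude s B hN, norm_mul, mul_comm]
  congr 1
  rw [norm_prod]
  refine Finset.prod_congr rfl fun l _ => ?_
  rw [rpow_sliceExponent s hs, norm_zpow, Complex.norm_natCast]

theorem couplingFactor_rectangular [Fintype I] (s : Fin d → Fin L) (B : I → Bubble d) {N : Fin L → ℕ}
    (hN : ∀ l, 1 ≤ N l) (b : I →₀ ℕ) :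
    (rectangularModel s B N).couplingFactor b =
      ((-1) ^ (∑ i, b i) / ∏ i, (Nat.factorial (b i) : ℂ)) * ∏ i, bubbleFactor s N (B i) ^ b i := by
  rw [Model.couplingFactor, Finset.prod_div_distrib, ← Finset.prod_pow_eq_pow_sum,
    div_mul_eq_mul_div, ← Finset.prod_mul_distrib]
  congr 1
  refine Finset.prod_congr rfl fun i _ => ?_
  rw [scale_mul_suppression s B hN, ← mul_pow, neg_one_mul]

theorem coeff_freeEnergy_rectangular [Fintype I] (s : Fin d → Fin L) (B : I → Bubble d)
    {N : Fin L → ℕ} (hN : ∀ l, 1 ≤ N l) (b : I →₀ ℕ) :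
    MvPowerSeries.coeff b (rectangularModel s B N).freeEnergy =
      -((-1) ^ (∑ i, b i) / ∏ i, (Nat.factorial (b i) : ℂ)) *
        ∑ φ ∈ connectedContractions (copies B b),
          ∏ l, (N l : ℂ) ^ faceExponent s (copies B b) φ l := by
  rw [Model.freeEnergy_eq _ (scale_pos s B hN), map_neg, Model.coeff_connectedSeries,
    couplingFactor_rectangular s B hN, neg_mul, mul_assoc, neg_inj, connectedSum]
  congr 1
  rw [Finset.mul_sum]
  refine Finset.sum_congr rfl fun φ _ => ?_
  rw [← graphWeight_mul_prod s B hN (copies B b) φ, prod_copies B b (bubbleFactor s N)]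
  rfl

theorem coeff_expectation_rectangular [Fintype I] (s : Fin d → Fin L) (B : I → Bubble d)
    {N : Fin L → ℕ} (hN : ∀ l, 1 ≤ N l) (B₀ : Bubble d) (b : I →₀ ℕ) :
    MvPowerSeries.coeff b ((rectangularModel s B N).expectation B₀) =
      (∏ l, (N l : ℂ) ^ bubbleComp s B₀ l) *
        ((-1) ^ (∑ i, b i) / ∏ i, (Nat.factorial (b i) : ℂ)) *
        ∑ φ ∈ connectedContractions (markedCopies B₀ B b),
          ∏ l, (N l : ℂ) ^ (faceExponent s (markedCopies B₀ B b) φ l - width s l) := by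
  have hN0 : ∀ l, (N l : ℂ) ≠ 0 := fun l => Nat.cast_ne_zero.2 (Nat.one_le_iff_ne_zero.1 (hN l))
  rw [Model.expectation_eq _ (scale_pos s B hN), Model.coeff_markedSeries,
    couplingFactor_rectangular s B hN, mul_comm (∏ l, _) (_ / _), mul_assoc, mul_assoc, connectedSum]
  congr 1
  rw [Finset.mul_sum, Finset.mul_sum]
  refine Finset.sum_congr rfl fun φ _ => ?_
  have h := graphWeight_mul_prod s B hN (markedCopies B₀ B b) φ
  rw [Fintype.prod_option] at h
  change bubbleFactor s N B₀ * (∏ j, bubbleFactor s N (copies B b j)) * _ = _ at h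
  rw [prod_copies B b (bubbleFactor s N)] at h
  -- The marked bubble is an insertion and carries no factor of scale and suppression. Dividing by
  -- its `bubbleFactor`, the product of the N_l^(Δ_l - n(B₀^(l))), produces the prefactor
  -- N_l^(n(B₀^(l))) and the shift of the exponents by -Δ_l.
  have h2 : (∏ l, (N l : ℂ) ^ bubbleComp s B₀ l) *
      ∏ l, (N l : ℂ) ^ (faceExponent s (markedCopies B₀ B b) φ l - width s l) =
      (bubbleFactor s N B₀)⁻¹ * ∏ l, (N l : ℂ) ^ faceExponent s (markedCopies B₀ B b) φ l := by
    rw [bubbleFactor, ← Finset.prod_inv_distrib, ← Finset.prod_mul_distrib,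
      ← Finset.prod_mul_distrib]
    refine Finset.prod_congr rfl fun l _ => ?_
    rw [← zpow_neg, ← zpow_natCast, ← zpow_add₀ (hN0 l), ← zpow_add₀ (hN0 l)]
    congr 1
    ring
  have h0 : bubbleFactor s N B₀ ≠ 0 := Finset.prod_ne_zero_iff.2 fun l _ => zpow_ne_zero _ (hN0 l)
  rw [h2, ← h, mul_assoc, inv_mul_cancel_left₀ h0]
  rfl

theorem ofReal_prod_rpow_sliceExponent [Fintype J] (s : Fin d → Fin L) (hs : ∀ l, 2 ≤ width s l)
    (B : J → Bubble d) (φ : Vertices B ≃ Vertices B) (N : Fin L → ℕ) :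
    ((∏ l, (N l : ℝ) ^ ((sliceExponent s B φ l : ℚ) : ℝ) : ℝ) : ℂ) =
      ∏ l, (N l : ℂ) ^ faceExponent s B φ l := by
  simp only [rpow_sliceExponent s hs]
  push_cast
  rfl

theorem ofReal_prod_rpow_sliceExponent_sub [Fintype J] (s : Fin d → Fin L)
    (hs : ∀ l, 2 ≤ width s l) (B : J → Bubble d) (φ : Vertices B ≃ Vertices B) (N : Fin L → ℕ) :
    ((∏ l, (N l : ℝ) ^ ((sliceExponent s B φ l - (width s l : ℚ) : ℚ) : ℝ) : ℝ) : ℂ) =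
      ∏ l, (N l : ℂ) ^ (faceExponent s B φ l - width s l) := by
  rw [Complex.ofReal_prod]
  refine Finset.prod_congr rfl fun l _ => ?_
  have h : sliceExponent s B φ l - (width s l : ℚ) =
      ((faceExponent s B φ l - width s l : ℤ) : ℚ) := by
    rw [sliceExponent_eq s B φ l (hs l)]
    push_cast
    rfl
  rw [h, Rat.cast_intCast, Real.rpow_intCast]
  push_cast
  rfl

/-! ### Polynomials in the inverse sizes -/

/-- The polynomial in the inverse sizes that collects the connected graphs. -/
def expansionPolynomial [Fintype J] (s : Fin d → Fin L) (B : J → Bubble d) (q : ℚ) :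
    MvPolynomial (Fin L) ℚ :=
  MvPolynomial.C q * ∑ φ ∈ connectedContractions B,
    ∏ l, MvPolynomial.X l ^ ((width s l : ℤ) - faceExponent s B φ l).toNat

theorem aeval_expansionPolynomial [Fintype J] (s : Fin d → Fin L) (hs : ∀ l, 2 ≤ width s l)
    (B : J → Bubble d) (q : ℚ) (N : Fin L → ℕ) :
    MvPolynomial.aeval (fun l => (N l : ℂ)⁻¹) (expansionPolynomial s B q) =
      (q : ℂ) * ∑ φ ∈ connectedContractions B,
        ∏ l, (N l : ℂ) ^ (faceExponent s B φ l - width s l) := by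
  rw [expansionPolynomial, map_mul, map_sum, MvPolynomial.aeval_C]
  congr 1
  refine Finset.sum_congr rfl fun φ hφ => ?_
  rw [map_prod]
  refine Finset.prod_congr rfl fun l _ => ?_
  -- Connectedness makes Δ_l minus the exponent non-negative, so the truncation `toNat` loses
  -- nothing and only inverse powers occur.
  have h := faceExponent_le s B (mem_connectedContractions.1 hφ) l (hs l)
  rw [map_pow, MvPolynomial.aeval_X, ← zpow_natCast, Int.toNat_of_nonneg (by omega), inv_zpow',
    neg_sub]

theorem prod_zpow_eq_mul [Fintype J] (s : Fin d → Fin L) (B : J → Bubble d)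
    (φ : Vertices B ≃ Vertices B) {N : Fin L → ℕ} (hN : ∀ l, 1 ≤ N l) :
    ∏ l, (N l : ℂ) ^ faceExponent s B φ l = (∏ l, (N l : ℂ) ^ width s l) *
      ∏ l, (N l : ℂ) ^ (faceExponent s B φ l - width s l) := by
  rw [← Finset.prod_mul_distrib]
  refine Finset.prod_congr rfl fun l _ => ?_
  rw [← zpow_natCast, ← zpow_add₀ (Nat.cast_ne_zero.2 (Nat.one_le_iff_ne_zero.1 (hN l))),
    add_sub_cancel]

theorem exists_polynomial_freeEnergy_rectangular [Fintype I] (s : Fin d → Fin L)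
    (hs : ∀ l, 2 ≤ width s l) (B : I → Bubble d) (b : I →₀ ℕ) :
    ∃ P : MvPolynomial (Fin L) ℚ, ∀ N : Fin L → ℕ, (∀ l, 1 ≤ N l) →
      MvPowerSeries.coeff b (rectangularModel s B N).freeEnergy =
        (∏ l, (N l : ℂ) ^ width s l) * MvPolynomial.aeval (fun l => (N l : ℂ)⁻¹) P := by
  refine ⟨expansionPolynomial s (copies B b)
    (-((-1) ^ (∑ i, b i) / ∏ i, (Nat.factorial (b i) : ℚ))), fun N hN => ?_⟩
  rw [aeval_expansionPolynomial s hs, coeff_freeEnergy_rectangular s B hN,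
    Finset.sum_congr rfl fun φ _ => prod_zpow_eq_mul s (copies B b) φ hN, ← Finset.mul_sum]
  push_cast
  ring

theorem exists_polynomial_expectation_rectangular [Fintype I] (s : Fin d → Fin L)
    (hs : ∀ l, 2 ≤ width s l) (B : I → Bubble d) (B₀ : Bubble d) (b : I →₀ ℕ) :
    ∃ P : MvPolynomial (Fin L) ℚ, ∀ N : Fin L → ℕ, (∀ l, 1 ≤ N l) →
      MvPowerSeries.coeff b ((rectangularModel s B N).expectation B₀) =
        (∏ l, (N l : ℂ) ^ bubbleComp s B₀ l) *
          MvPolynomial.aeval (fun l => (N l : ℂ)⁻¹) P := by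
  refine ⟨expansionPolynomial s (markedCopies B₀ B b)
    ((-1) ^ (∑ i, b i) / ∏ i, (Nat.factorial (b i) : ℚ)), fun N hN => ?_⟩
  rw [aeval_expansionPolynomial s hs, coeff_expectation_rectangular s B hN]
  push_cast
  ring

/-! ### Tensors of the same size in every direction -/

/-- The sum of the Δ_l - 1 over the slices is d - L, and that of the 1 - n(B_i^(l)) is the exponent
of the square suppression. -/
theorem squareModel_eq (s : Fin d → Fin L) (B : I → Bubble d) {N : ℕ} (hN : 1 ≤ N) :
    squareModel s B N = rectangularModel s B fun _ => N := by
  have hN0 : (N : ℝ) ≠ 0 := Nat.cast_ne_zero.2 (Nat.one_le_iff_ne_zero.1 hN)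
  simp only [squareModel, rectangularModel, prod_zpow_eq_zpow_sum _ hN0, Finset.sum_sub_distrib,
    Finset.sum_const, Finset.card_univ, Fintype.card_fin, nsmul_eq_mul, mul_one]
  rw [← Nat.cast_sum, sum_width]

/-- The bubbles and sizes of the two models agree by definition, so it suffices to compare scales
and suppressions in the formula `amplitude_eq`. -/
theorem square_amplitude [Fintype I] (s : Fin d → Fin L) (B : I → Bubble d) {N : ℕ}
    (hN : 1 ≤ N) (t : I → ℂ) (b : I →₀ ℕ)
    (φ : Vertices (copies B b) ≃ Vertices (copies B b)) :
    (squareModel s B N).amplitude t b φ =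
      (rectangularModel s B fun _ => N).amplitude t b φ := by
  have h := squareModel_eq s B hN
  have h1 : (squareModel s B N).scale = _ := congrArg Model.scale h
  have h2 : (squareModel s B N).suppression = _ := congrArg Model.suppression h
  refine (amplitude_eq (squareModel s B N) t b φ).trans
    (Eq.trans ?_ (amplitude_eq (rectangularModel s B fun _ => N) t b φ).symm)
  change (∏ i, ((((squareModel s B N).scale * (squareModel s B N).suppression i : ℝ) : ℂ) *
    t i) ^ b i) * graphWeight (fun _ => N) ((squareModel s B N).scale : ℂ)⁻¹ (copies B b) φ = _
  rw [h1, h2]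
  rfl

theorem prod_rpow_eq_rpow_sum {N : ℕ} (hN : 1 ≤ N) (q : Fin L → ℚ) :
    ∏ l, (N : ℝ) ^ ((q l : ℚ) : ℝ) = (N : ℝ) ^ ((∑ l, q l : ℚ) : ℝ) := by
  rw [Rat.cast_sum, Real.rpow_sum_of_pos]
  exact_mod_cast hN

theorem sum_faceExponent_copies [Fintype I] (s : Fin d → Fin L) (B : I → Bubble d) (b : I →₀ ℕ)
    (φ : Vertices (copies B b) ≃ Vertices (copies B b)) :
    ∑ l, faceExponent s (copies B b) φ l =
      (∑ c : Fin d, ((feynmanGraph (copies B b) φ).faces none (some c) : ℤ))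
        - ((d : ℤ) - (L : ℤ)) * ∑ i, (b i : ℤ) * ((B i).p : ℤ) + (d : ℤ) * ∑ i, (b i : ℤ)
        - ∑ i, (b i : ℤ) * ∑ l, (bubbleComp s (B i) l : ℤ) := by
  have hw : ∑ l, (width s l : ℤ) = d := by rw [← Nat.cast_sum, sum_width]
  simp only [faceExponent_copies]
  rw [Finset.sum_sub_distrib, Finset.sum_sub_distrib, sum_slice, ← Finset.sum_mul,
    Finset.sum_sub_distrib, hw, Finset.sum_comm]
  simp only [← Finset.mul_sum, Finset.sum_sub_distrib, mul_sub, Finset.sum_const, Finset.card_univ,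
    Fintype.card_fin, nsmul_eq_mul, mul_one]
  ring

/-- Equating all sizes identifies the variables, turning the polynomial in several inverse sizes
into one in 1/N. -/
theorem aeval_aeval_X (P : MvPolynomial (Fin L) ℚ) (z : ℂ) :
    Polynomial.aeval z (MvPolynomial.aeval (fun _ => (Polynomial.X : Polynomial ℚ)) P) =
      MvPolynomial.aeval (fun _ => z) P := by
  have h := MvPolynomial.comp_aeval_apply (fun _ : Fin L => (Polynomial.X : Polynomial ℚ))
    (Polynomial.aeval z) P
  simpa using h

end Powers

end TensorModel

end

/-! ### The main theorem -/

open TensorModel in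
theorem mainTheorem1 {d L : ℕ} (s : Fin d → Fin L) (hs : ∀ l, 2 ≤ width s l)
    {I : Type} [Fintype I] (B : I → Bubble d) :
    -- the slices of a connected Feynman graph: components and degrees
    (∀ (b : I →₀ ℕ), ∀ φ ∈ connectedContractions (copies B b), ∀ l : Fin L,
      (graphComp s (feynmanGraph (copies B b) φ) l : ℤ)
          ≤ 1 + ∑ i, (b i : ℤ) * ((bubbleComp s (B i) l : ℤ) - 1) ∧
      ∃ m : ℕ, (m : ℚ) =
        2 / (Nat.factorial (width s l - 1) : ℚ) * graphDegree s (feynmanGraph (copies B b) φ) l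
          - 2 / (Nat.factorial (width s l - 2) : ℚ) * ∑ i, (b i : ℚ) * bubbleDegree s (B i) l) ∧
    -- the amplitudes
    (∀ (N : ℕ), 1 ≤ N → ∀ (t : I → ℂ) (b : I →₀ ℕ), ∀ φ ∈ connectedContractions (copies B b),
      (squareModel s B N).amplitude t b φ =
        (N : ℂ) ^ ((∑ c : Fin d, ((feynmanGraph (copies B b) φ).faces none (some c) : ℤ))
          - ((d : ℤ) - (L : ℤ)) * ∑ i, (b i : ℤ) * ((B i).p : ℤ)
          + (d : ℤ) * ∑ i, (b i : ℤ)
          - ∑ i, (b i : ℤ) * ∑ l, (bubbleComp s (B i) l : ℤ)) * ∏ i, t i ^ b i ∧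
      ‖(squareModel s B N).amplitude t b φ‖ =
        ‖∏ i, t i ^ b i‖ * (N : ℝ) ^ ((∑ l, sliceExponent s (copies B b) φ l : ℚ) : ℝ) ∧
      ‖(squareModel s B N).amplitude t b φ‖ ≤
        ‖∏ i, t i ^ b i‖ * (N : ℝ) ^ (((d : ℚ) - ∑ l : Fin L,
          (2 / (Nat.factorial (width s l - 1) : ℚ) * graphDegree s (feynmanGraph (copies B b) φ) l
            - 2 / (Nat.factorial (width s l - 2) : ℚ) *
                ∑ i, (b i : ℚ) * bubbleDegree s (B i) l) : ℚ) : ℝ) ∧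
      ‖(squareModel s B N).amplitude t b φ‖ ≤ ‖∏ i, t i ^ b i‖ * (N : ℝ) ^ d) ∧
    -- the free energy
    (∀ b : I →₀ ℕ,
      (∀ N : ℕ, 1 ≤ N →
        MvPowerSeries.coeff b (squareModel s B N).freeEnergy =
          -((-1) ^ (∑ i, b i) / ∏ i, (Nat.factorial (b i) : ℂ)) *
            ∑ φ ∈ connectedContractions (copies B b),
              (((N : ℝ) ^ ((∑ l, sliceExponent s (copies B b) φ l : ℚ) : ℝ) : ℝ) : ℂ)) ∧
      ∃ P : Polynomial ℚ, ∀ N : ℕ, 1 ≤ N →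
        MvPowerSeries.coeff b (squareModel s B N).freeEnergy =
          (N : ℂ) ^ d * Polynomial.aeval ((N : ℂ)⁻¹) P) ∧
    -- the expectation values of bubbles
    (∀ (B₀ : Bubble d) (b : I →₀ ℕ),
      (∀ φ ∈ connectedContractions (markedCopies B₀ B b), ∀ l,
        sliceExponent s (markedCopies B₀ B b) φ l ≤ (width s l : ℚ)) ∧
      (∀ N : ℕ, 1 ≤ N →
        MvPowerSeries.coeff b ((squareModel s B N).expectation B₀) =
          (N : ℂ) ^ (∑ l, bubbleComp s B₀ l) *
            ((-1) ^ (∑ i, b i) / ∏ i, (Nat.factorial (b i) : ℂ)) *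
              ∑ φ ∈ connectedContractions (markedCopies B₀ B b),
                (((N : ℝ) ^ ((∑ l, (sliceExponent s (markedCopies B₀ B b) φ l
                  - (width s l : ℚ)) : ℚ) : ℝ) : ℝ) : ℂ)) ∧
      ∃ P : Polynomial ℚ, ∀ N : ℕ, 1 ≤ N →
        MvPowerSeries.coeff b ((squareModel s B N).expectation B₀) =
          (N : ℂ) ^ (∑ l, bubbleComp s B₀ l) * Polynomial.aeval ((N : ℂ)⁻¹) P) ∧
    -- rectangular tensors: the amplitudes
    (∀ (N : Fin L → ℕ), (∀ l, 1 ≤ N l) → ∀ (t : I → ℂ) (b : I →₀ ℕ),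
      ∀ φ ∈ connectedContractions (copies B b),
      (rectangularModel s B N).amplitude t b φ =
        (∏ l, (N l : ℂ) ^ ((∑ c ∈ slice s l,
              ((feynmanGraph (copies B b) φ).faces none (some c) : ℤ))
            - ((width s l : ℤ) - 1) * (∑ i, (b i : ℤ) * ((B i).p : ℤ) - ∑ i, (b i : ℤ))
            - ∑ i, (b i : ℤ) * ((bubbleComp s (B i) l : ℤ) - 1))) * ∏ i, t i ^ b i ∧
      ‖(rectangularModel s B N).amplitude t b φ‖ =
        ‖∏ i, t i ^ b i‖ * ∏ l, (N l : ℝ) ^ ((sliceExponent s (copies B b) φ l : ℚ) : ℝ) ∧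
      ‖(rectangularModel s B N).amplitude t b φ‖ ≤
        ‖∏ i, t i ^ b i‖ * ∏ l, (N l : ℝ) ^ (((width s l : ℚ) -
          (2 / (Nat.factorial (width s l - 1) : ℚ) * graphDegree s (feynmanGraph (copies B b) φ) l
            - 2 / (Nat.factorial (width s l - 2) : ℚ) *
                ∑ i, (b i : ℚ) * bubbleDegree s (B i) l) : ℚ) : ℝ) ∧
      ‖(rectangularModel s B N).amplitude t b φ‖ ≤
        ‖∏ i, t i ^ b i‖ * ∏ l, (N l : ℝ) ^ width s l) ∧
    -- rectangular tensors: the free energy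
    (∀ b : I →₀ ℕ,
      (∀ N : Fin L → ℕ, (∀ l, 1 ≤ N l) →
        MvPowerSeries.coeff b (rectangularModel s B N).freeEnergy =
          -((-1) ^ (∑ i, b i) / ∏ i, (Nat.factorial (b i) : ℂ)) *
            ∑ φ ∈ connectedContractions (copies B b),
              ((∏ l, (N l : ℝ) ^ ((sliceExponent s (copies B b) φ l : ℚ) : ℝ) : ℝ) : ℂ)) ∧
      ∃ P : MvPolynomial (Fin L) ℚ, ∀ N : Fin L → ℕ, (∀ l, 1 ≤ N l) →
        MvPowerSeries.coeff b (rectangularModel s B N).freeEnergy =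
          (∏ l, (N l : ℂ) ^ width s l) * MvPolynomial.aeval (fun l => (N l : ℂ)⁻¹) P) ∧
    -- rectangular tensors: the expectation values of bubbles
    (∀ (B₀ : Bubble d) (b : I →₀ ℕ),
      (∀ N : Fin L → ℕ, (∀ l, 1 ≤ N l) →
        MvPowerSeries.coeff b ((rectangularModel s B N).expectation B₀) =
          (∏ l, (N l : ℂ) ^ bubbleComp s B₀ l) *
            ((-1) ^ (∑ i, b i) / ∏ i, (Nat.factorial (b i) : ℂ)) *
              ∑ φ ∈ connectedContractions (markedCopies B₀ B b),
                ((∏ l, (N l : ℝ) ^ ((sliceExponent s (markedCopies B₀ B b) φ l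
                  - (width s l : ℚ) : ℚ) : ℝ) : ℝ) : ℂ)) ∧
      ∃ P : MvPolynomial (Fin L) ℚ, ∀ N : Fin L → ℕ, (∀ l, 1 ≤ N l) →
        MvPowerSeries.coeff b ((rectangularModel s B N).expectation B₀) =
          (∏ l, (N l : ℂ) ^ bubbleComp s B₀ l) *
            MvPolynomial.aeval (fun l => (N l : ℂ)⁻¹) P) := by
  have hpart : ∀ (b : I →₀ ℕ), ∀ φ ∈ connectedContractions (copies B b), ∀ l : Fin L,
      (graphComp s (feynmanGraph (copies B b) φ) l : ℤ)
          ≤ 1 + ∑ i, (b i : ℤ) * ((bubbleComp s (B i) l : ℤ) - 1) := by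
    intro b φ hφ l
    rw [← sum_copies B b fun B => (bubbleComp s B l : ℤ) - 1]
    exact graphComp_le s _ (mem_connectedContractions.1 hφ) l
  -- Both bounds are proved for rectangular tensors, slice by slice, from sizes at least 1: the
  -- first uses the bound on n(G^(l)), the second also Ω_l ≥ 0. The square bounds specialize them.
  have hamp : ∀ (N : Fin L → ℕ), (∀ l, 1 ≤ N l) → ∀ (t : I → ℂ) (b : I →₀ ℕ),
      ∀ φ ∈ connectedContractions (copies B b),
      ‖(rectangularModel s B N).amplitude t b φ‖ ≤
        ‖∏ i, t i ^ b i‖ * ∏ l, (N l : ℝ) ^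
          ((((width s l : ℚ) - degreePart s (copies B b) φ l) : ℚ) : ℝ) ∧
      ‖(rectangularModel s B N).amplitude t b φ‖ ≤
        ‖∏ i, t i ^ b i‖ * ∏ l, (N l : ℝ) ^ width s l := by
    intro N hN t b φ hφ
    have hc := mem_connectedContractions.1 hφ
    have hN' : ∀ l, (1 : ℝ) ≤ N l := fun l => by exact_mod_cast hN l
    rw [norm_rectangular_amplitude s hs B hN]
    refine ⟨mul_le_mul_of_nonneg_left (Finset.prod_le_prod (fun l _ => by positivity)
        fun l _ => Real.rpow_le_rpow_of_exponent_le (hN' l) ?_) (norm_nonneg _),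
      mul_le_mul_of_nonneg_left (Finset.prod_le_prod (fun l _ => by positivity)
        fun l _ => ?_) (norm_nonneg _)⟩
    · exact Rat.cast_le.2 (sliceExponent_le_sub s _ hc l)
    · rw [← Real.rpow_natCast]
      refine Real.rpow_le_rpow_of_exponent_le (hN' l) ?_
      have h := sliceExponent_le s _ hc l (hs l)
      have h' : ((sliceExponent s (copies B b) φ l : ℚ) : ℝ) ≤ ((width s l : ℚ) : ℝ) :=
        Rat.cast_le.2 h
      simpa using h'
  refine ⟨fun b φ hφ l => ⟨hpart b φ hφ l, ?_⟩, fun N hN t b φ hφ => ⟨?_, ?_, ?_, ?_⟩,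
    fun b => ⟨fun N hN => ?_, ?_⟩, fun B₀ b => ⟨fun φ hφ l => ?_, fun N hN => ?_, ?_⟩,
    fun N hN t b φ hφ => ⟨?_, ?_, ?_, ?_⟩, fun b => ⟨fun N hN => ?_, ?_⟩,
    fun B₀ b => ⟨fun N hN => ?_, ?_⟩⟩
  · rw [← degreePart_copies]
    exact exists_nat_eq_degreePart s _ φ l (hs l)
  · rw [square_amplitude s B hN, rectangular_amplitude s B fun _ => hN, ← sum_faceExponent_copies,
      prod_zpow_eq_zpow_sum _ (Nat.cast_ne_zero.2 (Nat.one_le_iff_ne_zero.1 hN))]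
  · rw [square_amplitude s B hN, norm_rectangular_amplitude s hs B fun _ => hN,
      prod_rpow_eq_rpow_sum hN]
  · simp only [← degreePart_copies]
    have h := (hamp (fun _ => N) (fun _ => hN) t b φ hφ).1
    rw [prod_rpow_eq_rpow_sum hN, Finset.sum_sub_distrib, ← Nat.cast_sum, sum_width] at h
    rw [square_amplitude s B hN]
    exact h
  · have h := (hamp (fun _ => N) (fun _ => hN) t b φ hφ).2
    rw [Finset.prod_pow_eq_pow_sum, sum_width] at h
    rw [square_amplitude s B hN]
    exact h
  · rw [squareModel_eq s B hN, coeff_freeEnergy_rectangular s B fun _ => hN]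
    congr 1
    refine Finset.sum_congr rfl fun φ _ => ?_
    rw [← prod_rpow_eq_rpow_sum hN, ← ofReal_prod_rpow_sliceExponent s hs]
  · obtain ⟨P, hP⟩ := exists_polynomial_freeEnergy_rectangular s hs B b
    refine ⟨MvPolynomial.aeval (fun _ => (Polynomial.X : Polynomial ℚ)) P, fun N hN => ?_⟩
    rw [squareModel_eq s B hN, hP _ fun _ => hN, Finset.prod_pow_eq_pow_sum, sum_width,
      aeval_aeval_X]
  · exact sliceExponent_le s _ (mem_connectedContractions.1 hφ) l (hs l)
  · rw [squareModel_eq s B hN, coeff_expectation_rectangular s B fun _ => hN,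
      Finset.prod_pow_eq_pow_sum]
    congr 1
    refine Finset.sum_congr rfl fun φ _ => ?_
    rw [← prod_rpow_eq_rpow_sum hN, ← ofReal_prod_rpow_sliceExponent_sub s hs]
  · obtain ⟨P, hP⟩ := exists_polynomial_expectation_rectangular s hs B B₀ b
    refine ⟨MvPolynomial.aeval (fun _ => (Polynomial.X : Polynomial ℚ)) P, fun N hN => ?_⟩
    rw [squareModel_eq s B hN, hP _ fun _ => hN, Finset.prod_pow_eq_pow_sum, aeval_aeval_X]
  · rw [rectangular_amplitude s B hN]
    simp only [faceExponent_copies]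
  · exact norm_rectangular_amplitude s hs B hN t b φ
  · simp only [← degreePart_copies]
    exact (hamp N hN t b φ hφ).1
  · exact (hamp N hN t b φ hφ).2
  · rw [coeff_freeEnergy_rectangular s B hN]
    congr 1
    exact Finset.sum_congr rfl fun φ _ => (ofReal_prod_rpow_sliceExponent s hs _ φ N).symm
  · exact exists_polynomial_freeEnergy_rectangular s hs B b
  · rw [coeff_expectation_rectangular s B hN]
    congr 1
    exact Finset.sum_congr rfl fun φ _ => (ofReal_prod_rpow_sliceExponent_sub s hs _ φ N).symm
  · exact exists_polynomial_expectation_rectangular s hs B B₀ b
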